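/- **Setting.** Let $\mathcal X$ be a second countable topological space with its Borel $\sigma$-algebra, $P_0$ a Borel probability measure on $\mathcal X$, $\mathscr H$ a real Hilbert space and $\psi:\mathcal X\to\mathscr H$ a map whose Stein kernel $K_0(x,y)=\langle\psi(x),\psi(y)\rangle_{\mathscr H}$ is continuous with $\int K_0(x,x)\,dP_0(x)<\infty$, and with $\mathbb E_{P_0}\psi(X)=0$. Let $\Upsilon:L^2(P_0)\to L^2(P_0)$, $\Upsilon f=\int K_0(\cdot,y)f(y)\,dP_0(y)$, and let $(\lambda_i,\tilde\phi_i)_{i\ge1}$ be its eigensystem: $\lambda_i>0$, $\Upsilon\tilde\phi_i=\lambda_i\tilde\phi_i$, and $(\tilde\phi_i)_{i\ge 1}$ is orthonormal with closed span $\overline{\mathrm{Ran}(\Upsilon)}$. Put $\phi_i(x)=\lambda_i^{-1}\int K_0(x,y)\tilde\phi_i(y)\,dP_0(y)$ and, for $\theta>0$, $\mathrm{Ran}(\Upsilon^\theta)=\{\sum_i\lambda_i^\theta\langle g,\tilde\phi_i\rangle\tilde\phi_i: g\in L^2(P_0)\}$. For $c,\kappa>0$ consider the moment condition $$\mathbf{A_2}(c,\kappa):\qquad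 \mathbb E_{P_0}[K_0(X,X)^r]\le c\,r!\,\kappa^r\quad\text{for all integers } r>2,$$ and let $\mathcal S_{c,\kappa}$ be the set of probability measures $P$ with $\mathbb E_P[K_0(X,X)^r]\le c\,r!\,\kappa^r$ for all integers $r>2$ and $\mathbb E_P K_0(X,X)<\infty$. For $\Delta>0$ let $$\mathcal P_{\theta,\Delta}^{c,\kappa}=\Big\{P\in\mathcal S_{c,\kappa}:\ P\ll P_0,\ \tfrac{dP}{dP_0}-1\in\mathrm{Ran}(\Upsilon^\theta),\ \chi^2(P,P_0)=\big\|\tfrac{dP}{dP_0}-1\big\|^2_{L^2(P_0)}\ge\Delta\Big\}.$$ A test based on $n$ observations is a measurable $\phi:\mathcal X^n\to[0,1]$ (with $\phi\in\{0,1\}$ if it is nonrandomized); its risk over a class $\mathcal P$ is $R_{\mathcal P}(\phi)=\sup_{P\in\mathcal P}\mathbb E_{P^n}(1-\phi)$, with $R_{\emptyset}=0$. For $\alpha\in(0,1)$ and classes $(\mathcal P_n)_n$, we say that *no asymptotic $\alpha$-level test is consistent over $(\mathcal P_n)_n$* if both $$\liminf_{n\to\infty}\ \inf_{\phi:\ \mathbb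 E_{P_0^n}\phi\le\alpha}R_{\mathcal P_n}(\phi)>0\qquad\text{and}\qquad \inf_{(\phi_n)_n}\ \liminf_{n\to\infty}R_{\mathcal P_n}(\phi_n)>0,$$ where the second infimum is over all sequences of tests with $\limsup_n\mathbb E_{P_0^n}\phi_n\le\alpha$. **Theorem (minimax separation).** If $\sup_i\|\phi_i\|_\infty<\infty$, then $\mathbf{A_2}(c,\kappa)$ holds for some $c,\kappa>0$. Moreover, let $c,\kappa>0$ be any constants for which $\mathbf{A_2}(c,\kappa)$ holds, let $\alpha\in(0,1)$, and let $(\Delta_n)$ be a sequence of positive numbers. 1. Suppose $\lambda_i\asymp i^{-\beta}$ with $\beta>1$ and $n^{\frac{4\theta\beta}{4\theta\beta+1}}\Delta_n\to0$, and that one of the following holds: (a) $\theta\ge1$ and $\sup_{x\in\mathcal X}\mathbb E_{P_0}[K_0(x,Y)^2]<\infty$; (b) $\theta\ge\frac1{4\beta}$ and $\sup_i\|\phi_i\|_\infty<\infty$. Then no asymptotic $\alpha$-level test is consistent over $(\mathcal P^{2c,\kappa}_{\theta,\Delta_n})_n$. 2. Suppose $\lambda_i\asymp e^{-\tau i}$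 with $\tau>0$, $\theta>0$ and $\frac{n}{\sqrt{\log n}}\Delta_n\to0$, and that $\sup_{x\in\mathcal X}\mathbb E_{P_0}[K_0(x,Y)^2]<\infty$ or $\sup_i\|\phi_i\|_\infty<\infty$. Then no asymptotic $\alpha$-level test is consistent over $(\mathcal P^{2c,\kappa}_{\theta,\Delta_n})_n$. -/

import Mathlib

open MeasureTheory Filter Topology
open scoped ENNReal RealInnerProductSpace

noncomputable section

namespace SteinTest

/-! ### The Stein kernel and its integral operator -/

section Kernel

variable {X : Type*} {H : Type*} [NormedAddCommGroup H] [InnerProductSpace ℝ H]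

/-- The Stein kernel `K₀(x, y) = ⟪ψ x, ψ y⟫` of a feature map `ψ`, where `ψ x` stands for the element
`ψ_{P₀}(·, x)` of the Hilbert space `H`. -/
def steinKernel (ψ : X → H) (x y : X) : ℝ := ⟪ψ x, ψ y⟫

variable [MeasurableSpace X]

/-- The function `x ↦ ∫ K(x, y) f(y) dP₀(y)`. It is a pointwise defined function. As an element of the
reproducing kernel Hilbert space of `K` it is `𝔍* f`; its class in `L²(P₀)` is `Υ f`. -/
def integralOp (K : X → X → ℝ) (P₀ : Measure X) (f : X → ℝ) (x : X) : ℝ :=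
  ∫ y, K x y * f y ∂P₀

/-- The range of the integral operator `Υ : L²(P₀) → L²(P₀)`. -/
def integralOpRange (K : X → X → ℝ) (P₀ : Measure X) : Set (Lp ℝ 2 P₀) :=
  {g | ∃ f : Lp ℝ 2 P₀, g =ᵐ[P₀] integralOp K P₀ f}

variable [TopologicalSpace X]

/-- The standing assumptions on the pair `(ψ, P₀)`: the Stein identity `E_{P₀} ψ(X) = 0`, continuity
of the Stein kernel, and `∫ K₀(x, x) dP₀(x) < ∞`. On a second countable Borel space the last two
make `ψ` Bochner integrable. -/
structure SteinAssumptions (ψ : X → H) (P₀ : Measure X) : Prop where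
  continuous_kernel : Continuous fun p : X × X => steinKernel ψ p.1 p.2
  integrable_diag : Integrable (fun x => steinKernel ψ x x) P₀
  stein_identity : ∫ x, ψ x ∂P₀ = 0

end Kernel

/-! ### Eigensystem of the integral operator -/

section Spectrum

variable {X : Type*} [MeasurableSpace X]

/-- `(eig i, e i)`, `i = 0, 1, 2, …`, is an (infinite) eigensystem of the integral operator: the
`eig i` are its positive eigenvalues, repeated according to multiplicity, and the `e i` are orthonormal
eigenfunctions in `L²(P₀)` that span the closure of the range. -/
structure IsEigensystem (K : X → X → ℝ) (P₀ : Measure X) (eig : ℕ → ℝ)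
    (e : ℕ → Lp ℝ 2 P₀) : Prop where
  pos : ∀ i, 0 < eig i
  orthonormal : Orthonormal ℝ e
  eigen : ∀ i, integralOp K P₀ (e i) =ᵐ[P₀] fun x => eig i * e i x
  complete : closure (Submodule.span ℝ (Set.range e) : Set (Lp ℝ 2 P₀)) =
    closure (integralOpRange K P₀)

/-- The range of the power `Υ^θ`, `θ > 0`, where
`Υ^θ g = ∑ i, (eig i)^θ ⟪e i, g⟫ e i`, with convergence in `L²(P₀)`. -/
def powRange {P₀ : Measure X} (eig : ℕ → ℝ) (e : ℕ → Lp ℝ 2 P₀) (θ : ℝ) : Set (Lp ℝ 2 P₀) :=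
  {f | ∃ g : Lp ℝ 2 P₀, HasSum (fun i => (eig i ^ θ * ⟪e i, g⟫) • e i) f}

/-- The pointwise defined representative `φᵢ = λᵢ⁻¹ 𝔍* e i` of the `i`-th eigenfunction. -/
def eigenfunction (K : X → X → ℝ) (P₀ : Measure X) (eig : ℕ → ℝ) (e : ℕ → Lp ℝ 2 P₀)
    (i : ℕ) (x : X) : ℝ :=
  (eig i)⁻¹ * integralOp K P₀ (e i) x

/-- `sup_i ‖φᵢ‖_∞ < ∞`. -/
def EigenfunctionsBounded (K : X → X → ℝ) (P₀ : Measure X) (eig : ℕ → ℝ)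
    (e : ℕ → Lp ℝ 2 P₀) : Prop :=
  ∃ M : ℝ, ∀ i x, |eigenfunction K P₀ eig e i x| ≤ M

/-- `sup_x E_{P₀} K(x, Y)² < ∞`. -/
def RowsBounded (K : X → X → ℝ) (P₀ : Measure X) : Prop :=
  ∃ M : ℝ, ∀ x, ∫⁻ y, ENNReal.ofReal (K x y ^ 2) ∂P₀ ≤ ENNReal.ofReal M

/-- `a i ≍ b i`. -/
def Comparable (a b : ℕ → ℝ) : Prop :=
  ∃ c₁ c₂ : ℝ, 0 < c₁ ∧ 0 < c₂ ∧ ∀ i, c₁ * b i ≤ a i ∧ a i ≤ c₂ * b i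

end Spectrum

/-! ### Alternatives, tests and risks -/

section Testing

variable {X : Type*} [MeasurableSpace X]

/-- `E_P [K(X, X)^r] ≤ c r! κ^r` for all integers `r > 2`. -/
def MomentBound (K : X → X → ℝ) (c κ : ℝ) (P : Measure X) : Prop :=
  ∀ r : ℕ, 2 < r → ∫⁻ x, ENNReal.ofReal (K x x ^ r) ∂P ≤ ENNReal.ofReal (c * r.factorial * κ ^ r)

/-- The class `𝒮` of probability measures with `E_P [K(X, X)^r] ≤ c r! κ^r` for all `r > 2` and
`E_P K(X, X) < ∞`. -/
def momentClass (K : X → X → ℝ) (c κ : ℝ) : Set (ProbabilityMeasure X) :=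
  {P | MomentBound K c κ P ∧ ∫⁻ x, ENNReal.ofReal (K x x) ∂(P : Measure X) < ∞}

/-- The class `𝒫_{θ,Δ}` of alternatives: the `P ∈ 𝒮` with `P ≪ P₀`, with
`dP/dP₀ - 1 ∈ Ran(Υ^θ)` in `L²(P₀)`, and with `χ²(P, P₀) = ‖dP/dP₀ - 1‖² ≥ Δ`. -/
def alternatives (K : X → X → ℝ) (P₀ : Measure X) (eig : ℕ → ℝ) (e : ℕ → Lp ℝ 2 P₀)
    (c κ θ Δ : ℝ) : Set (ProbabilityMeasure X) :=
  {P | P ∈ momentClass K c κ ∧ (P : Measure X) ≪ P₀ ∧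
    ∃ u : Lp ℝ 2 P₀, (u =ᵐ[P₀] fun x => ((P : Measure X).rnDeriv P₀ x).toReal - 1) ∧
      u ∈ powRange eig e θ ∧ Δ ≤ ‖u‖ ^ 2}

/-- A (possibly randomized) test based on `n` observations: `φ x` is the probability of rejecting
when the sample is `x`; a nonrandomized test has values in `{0, 1}`. -/
def IsTest {n : ℕ} (φ : (Fin n → X) → ℝ≥0∞) : Prop :=
  Measurable φ ∧ ∀ x, φ x ≤ 1

/-- The type-I error `E_{P₀ⁿ} φ`. -/
def typeI (P₀ : Measure X) {n : ℕ} (φ : (Fin n → X) → ℝ≥0∞) : ℝ≥0∞ :=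
  ∫⁻ x, φ x ∂(Measure.pi fun _ : Fin n => P₀)

/-- The worst-case type-II error `sup_{P ∈ Alt} E_{Pⁿ} (1 - φ)`. -/
def typeII (Alt : Set (ProbabilityMeasure X)) {n : ℕ} (φ : (Fin n → X) → ℝ≥0∞) : ℝ≥0∞ :=
  ⨆ P ∈ Alt, ∫⁻ x, (1 - φ x) ∂(Measure.pi fun _ : Fin n => (P : Measure X))

/-- The tests of level `α` based on `n` observations. -/
def levelTests (P₀ : Measure X) (α : ℝ) (n : ℕ) : Set ((Fin n → X) → ℝ≥0∞) :=
  {φ | IsTest φ ∧ typeI P₀ φ ≤ ENNReal.ofReal α}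

/-- The asymptotic `α`-level tests: sequences of tests, one for each sample size, whose type-I errors
have limit superior at most `α`. -/
def asymptoticTests (P₀ : Measure X) (α : ℝ) : Set ((n : ℕ) → (Fin n → X) → ℝ≥0∞) :=
  {φ | (∀ n, IsTest (φ n)) ∧ limsup (fun n => typeI P₀ (φ n)) atTop ≤ ENNReal.ofReal α}

/-- No test is consistent against the classes `Alt n`, uniformly over tests, in both senses: the
smallest worst-case type-II error of a level-`α` test for `n` observations stays away from `0` as
`n → ∞`; and so does, uniformly, the worst-case type-II error of any asymptotic `α`-level test. -/
def NoConsistentTest (P₀ : Measure X) (Alt : ℕ → Set (ProbabilityMeasure X)) (α : ℝ) : Prop :=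
  0 < liminf (fun n => ⨅ φ ∈ levelTests P₀ α n, typeII (Alt n) φ) atTop ∧
  0 < ⨅ φ ∈ asymptoticTests P₀ α, liminf (fun n => typeII (Alt n) (φ n)) atTop

end Testing

end SteinTest

end

/-! The argument is Le Cam's second moment method. Perturb `P₀` to densities `1 + u j` for finitely
many `j`, and let `A` be the average of the `n`-fold likelihood ratios. Any test has error sum at
least `1 - E|A - 1|`, and `E|A - 1| ≤ √(E A² - 1)`, where `E A²` is the average over `j, k` of `(1 +
∫ u j * u k)ⁿ`. It remains to find families inside the alternatives with `E A² → 1`; any error sum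
with a vanishing deficit then excludes consistency because `α < 1`.

The `u j` are finite combinations of eigenfunctions. They have mean zero by the Stein identity. They
lie in the range of every power `Υ^θ`, because the class puts no bound on the norm of the preimage.
If `|u j| ≤ 1`, the density is at most `2`, which turns the constant `c` into `2c`. So the only real
constraint is the sup norm.

If the eigenfunctions are uniformly bounded, take `√Δ φ_j` with `j` uniform among `N` indices. Then
`E A² ≤ 1 + (1 + Δ)ⁿ / N`, and `N` may be chosen after `n`, so `Δ → 0` is all that is needed.

If the rows of the kernel are bounded in `L²`, take the first `B` eigenfunctions with random signs
and coefficients `√(Δ / B)`. Cauchy-Schwarz gives the sup bound as long as `M Δ ≤ λ_i²` for the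
indices used, and `E A² ≤ exp((nΔ)² / B)`. Choosing `B` as large as the eigenvalue decay permits
(polynomial case), or of order `log n` (exponential case), makes `(nΔ)² / B → 0`.

The moment condition under bounded eigenfunctions follows from an almost sure bound on `K₀(x, x)`.
The normalized embeddings of the eigenfunctions are orthonormal in `H`, `ψ` lies almost surely in
their closed span, and its squared coefficients `λ_i φ_i(x)²` have bounded sum because the trace is
finite. -/

noncomputable section

namespace SteinTest

/-! ### Le Cam's second moment method for mixtures of product measures -/

section Mixture

variable {X : Type*} [MeasurableSpace X]

/-- The product of copies of a measure with density has the product density. -/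
theorem pi_withDensity_ofReal (P₀ : Measure X) [IsProbabilityMeasure P₀] {f : X → ℝ}
    (h0 : ∀ x, 0 ≤ f x) (hi : Integrable f P₀)
    [SigmaFinite (P₀.withDensity fun x => ENNReal.ofReal (f x))] (n : ℕ) :
    (Measure.pi fun _ : Fin n => P₀.withDensity fun x => ENNReal.ofReal (f x)) =
      (Measure.pi fun _ : Fin n => P₀).withDensity
        fun x => ENNReal.ofReal (∏ i, f (x i)) := by
  refine Measure.pi_eq fun s hs => ?_
  rw [withDensity_apply _ (MeasurableSet.univ_pi hs)]
  have hI : ∀ i, Integrable ((s i).indicator f) P₀ := fun i => hi.indicator (hs i)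
  -- On a box, the indicator times the product density is again a product of one-coordinate
  -- functions, so Fubini applies.
  have hind : ∀ x : Fin n → X, (Set.univ.pi s).indicator
      (fun x => ENNReal.ofReal (∏ i, f (x i))) x =
        ENNReal.ofReal (∏ i, (s i).indicator f (x i)) := by
    intro x
    by_cases hx : x ∈ Set.univ.pi s
    · rw [Set.indicator_of_mem hx]
      congr 1
      exact Finset.prod_congr rfl fun i _ => (Set.indicator_of_mem (hx i trivial) f).symm
    · rw [Set.indicator_of_notMem hx]
      simp only [Set.mem_pi, Set.mem_univ, true_implies, not_forall] at hx
      obtain ⟨i, hi⟩ := hx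
      rw [Finset.prod_eq_zero (Finset.mem_univ i) (Set.indicator_of_notMem hi f),
        ENNReal.ofReal_zero]
  rw [← lintegral_indicator (MeasurableSet.univ_pi hs), lintegral_congr hind,
    ← ofReal_integral_eq_lintegral_ofReal (Integrable.fintype_prod hI)
      (ae_of_all _ fun x => Finset.prod_nonneg fun i _ =>
        Set.indicator_nonneg (fun x _ => h0 x) _),
    integral_fintype_prod_eq_prod,
    ENNReal.ofReal_prod_of_nonneg fun i _ => integral_nonneg fun x =>
        Set.indicator_nonneg (fun x _ => h0 x) _]
  refine Finset.prod_congr rfl fun i _ => ?_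
  rw [ofReal_integral_eq_lintegral_ofReal (hI i)
      (ae_of_all _ fun x => Set.indicator_nonneg (fun x _ => h0 x) _),
    withDensity_apply _ (hs i), ← lintegral_indicator (hs i)]
  refine lintegral_congr fun x => ?_
  by_cases hx : x ∈ s i <;> simp [hx]

/-- The integrated deviation of a mixture of likelihood ratios from `1` is controlled by its second
moment. -/
theorem integral_abs_mixture_sub_one_le (P₀ : Measure X) [IsProbabilityMeasure P₀]
    {J : Type*} [Fintype J] [Nonempty J] {u : J → X → ℝ}
    (hm : ∀ j, Measurable (u j)) (hb : ∀ j x, |u j x| ≤ 1) (hz : ∀ j, ∫ x, u j x ∂P₀ = 0)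
    (n : ℕ) :
    Integrable (fun x : Fin n → X => |(Fintype.card J : ℝ)⁻¹ * ∑ j, ∏ i, (1 + u j (x i)) - 1|)
      (Measure.pi fun _ => P₀) ∧
    ∫ x : Fin n → X, |(Fintype.card J : ℝ)⁻¹ * ∑ j, ∏ i, (1 + u j (x i)) - 1|
        ∂(Measure.pi fun _ => P₀) ≤
      √(((Fintype.card J : ℝ)⁻¹ ^ 2 * ∑ j, ∑ k, (1 + ∫ x, u j x * u k x ∂P₀) ^ n) - 1) := by
  set Q : Measure (Fin n → X) := Measure.pi fun _ => P₀
  set N : ℝ := (Fintype.card J : ℝ)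
  have hN : N ≠ 0 := by simp [N]
  have hui : ∀ j, Integrable (u j) P₀ := fun j =>
    Integrable.of_bound (hm j).aestronglyMeasurable 1 (ae_of_all _ (hb j))
  have huui : ∀ j k, Integrable (fun x => u j x * u k x) P₀ := fun j k =>
    Integrable.of_bound ((hm j).mul (hm k)).aestronglyMeasurable 1 (ae_of_all _ fun x => by
      rw [Real.norm_eq_abs, abs_mul]
      exact mul_le_one₀ (hb j x) (abs_nonneg _) (hb k x))
  have hfi : ∀ j, Integrable (fun x => 1 + u j x) P₀ := fun j =>
    (integrable_const 1).add (hui j)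
  have hffe : ∀ j k, (fun x => (1 + u j x) * (1 + u k x)) =
      fun x => 1 + u j x + u k x + u j x * u k x := fun j k => by ext x; ring
  have hffi : ∀ j k, Integrable (fun x => (1 + u j x) * (1 + u k x)) P₀ := fun j k => by
    rw [hffe]; exact ((hfi j).add (hui k)).add (huui j k)
  have hff : ∀ j k, ∫ x, (1 + u j x) * (1 + u k x) ∂P₀ = 1 + ∫ x, u j x * u k x ∂P₀ := by
    intro j k
    have hs : Integrable (fun x => 1 + u j x + u k x) P₀ := (hfi j).add (hui k)
    rw [hffe, integral_add hs (huui j k), integral_add (hfi j) (hui k),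
      integral_add (integrable_const 1) (hui j), hz, hz]
    simp
  set L : J → (Fin n → X) → ℝ := fun j x => ∏ i, (1 + u j (x i))
  have hLi : ∀ j, Integrable (L j) Q := fun j => Integrable.fintype_prod fun _ => hfi j
  have hL : ∀ j, ∫ x, L j x ∂Q = 1 := by
    intro j
    have h1 : ∫ x, 1 + u j x ∂P₀ = 1 := by
      rw [integral_add (integrable_const 1) (hui j), hz]; simp
    simp only [L, Q]
    rw [integral_fintype_prod_eq_prod (fun (_ : Fin n) x => 1 + u j x)]
    simp [h1]
  have hLLe : ∀ j k, (fun x => L j x * L k x) =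
      fun x : Fin n → X => ∏ i, (fun y => (1 + u j y) * (1 + u k y)) (x i) := fun j k => by
    ext x; simp only [L, Finset.prod_mul_distrib]
  have hLLi : ∀ j k, Integrable (fun x => L j x * L k x) Q := fun j k => by
    rw [hLLe]; exact Integrable.fintype_prod fun _ => hffi j k
  have hLL : ∀ j k, ∫ x, L j x * L k x ∂Q = (1 + ∫ x, u j x * u k x ∂P₀) ^ n := fun j k => by
    rw [hLLe]
    simp only [Q]
    rw [integral_fintype_prod_eq_prod (fun (_ : Fin n) y => (1 + u j y) * (1 + u k y))]
    simp [hff]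
  set A : (Fin n → X) → ℝ := fun x => N⁻¹ * ∑ j, L j x
  have hAi : Integrable A Q := (integrable_finsetSum _ fun j _ => hLi j).const_mul _
  have hA1 : ∫ x, A x ∂Q = 1 := by
    simp only [A]
    rw [integral_const_mul, integral_finsetSum _ fun j _ => hLi j]
    simp only [hL, Finset.sum_const, Finset.card_univ, nsmul_eq_mul, mul_one]
    exact inv_mul_cancel₀ hN
  have hA2e : (fun x => A x ^ 2) = fun x => N⁻¹ ^ 2 * ∑ j, ∑ k, L j x * L k x := by
    ext x; simp only [A, mul_pow, sq (∑ j, L j x), Finset.sum_mul_sum]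
  have hA2i : Integrable (fun x => A x ^ 2) Q := by
    rw [hA2e]
    exact (integrable_finsetSum _ fun j _ => integrable_finsetSum _ fun k _ =>
      hLLi j k).const_mul _
  have hA2 : ∫ x, A x ^ 2 ∂Q =
      N⁻¹ ^ 2 * ∑ j, ∑ k, (1 + ∫ x, u j x * u k x ∂P₀) ^ n := by
    rw [hA2e, integral_const_mul,
      integral_finsetSum _ fun j _ => integrable_finsetSum _ fun k _ => hLLi j k]
    congr 1
    refine Finset.sum_congr rfl fun j _ => ?_
    rw [integral_finsetSum _ fun k _ => hLLi j k]
    exact Finset.sum_congr rfl fun k _ => hLL j k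
  have hDi : Integrable (fun x => |A x - 1|) Q := (hAi.sub (integrable_const 1)).abs
  have hsqe : (fun x => |A x - 1| ^ 2) = fun x => A x ^ 2 - 2 * A x + 1 := by
    ext x; rw [sq_abs]; ring
  have hsqi : Integrable (fun x => |A x - 1| ^ 2) Q := by
    rw [hsqe]; exact (hA2i.sub (hAi.const_mul 2)).add (integrable_const 1)
  have hcr : Integrable (fun x => A x ^ 2 - 2 * A x) Q := hA2i.sub (hAi.const_mul 2)
  have hsq : ∫ x, |A x - 1| ^ 2 ∂Q = (∫ x, A x ^ 2 ∂Q) - 1 := by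
    rw [hsqe, integral_add hcr (integrable_const 1),
      integral_sub hA2i (hAi.const_mul 2), integral_const_mul, hA1]
    simp; ring
  refine ⟨hDi, ?_⟩
  rw [← hA2, ← hsq]
  refine Real.le_sqrt_of_sq_le ?_
  -- Jensen's inequality, obtained from the nonnegativity of the variance of `|A - 1|`.
  set m := ∫ x, |A x - 1| ∂Q
  have h0 : 0 ≤ ∫ x, (|A x - 1| - m) ^ 2 ∂Q := integral_nonneg fun x => sq_nonneg _
  have he : (fun x => (|A x - 1| - m) ^ 2) =
      fun x => |A x - 1| ^ 2 - 2 * m * |A x - 1| + m ^ 2 := by ext x; ring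
  have hcr' : Integrable (fun x => |A x - 1| ^ 2 - 2 * m * |A x - 1|) Q :=
    hsqi.sub (hDi.const_mul _)
  rw [he, integral_add hcr' (integrable_const _),
    integral_sub hsqi (hDi.const_mul _), integral_const_mul] at h0
  simp only [integral_const, probReal_univ, one_smul] at h0
  nlinarith

/-- The second moment method for a finite mixture of alternatives. -/
theorem one_le_typeI_add_typeII_add (P₀ : Measure X) [IsProbabilityMeasure P₀]
    {Alt : Set (ProbabilityMeasure X)} {J : Type*} [Fintype J] [Nonempty J] {u : J → X → ℝ}
    (hm : ∀ j, Measurable (u j)) (hb : ∀ j x, |u j x| ≤ 1) (hz : ∀ j, ∫ x, u j x ∂P₀ = 0)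
    (hP : ∀ j, ∃ P ∈ Alt, (P : Measure X) = P₀.withDensity fun x => ENNReal.ofReal (1 + u j x))
    {n : ℕ} {φ : (Fin n → X) → ℝ≥0∞} (hφ : IsTest φ) {δ : ℝ}
    (hδ : √(((Fintype.card J : ℝ)⁻¹ ^ 2 *
      ∑ j, ∑ k, (1 + ∫ x, u j x * u k x ∂P₀) ^ n) - 1) ≤ δ) :
    1 ≤ typeI P₀ φ + typeII Alt φ + ENNReal.ofReal δ := by
  choose P hPA hPd using hP
  obtain ⟨hDi, hDle⟩ := integral_abs_mixture_sub_one_le P₀ hm hb hz n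
  set Q : Measure (Fin n → X) := Measure.pi fun _ => P₀ with hQ
  set N : ℝ := (Fintype.card J : ℝ) with hNdef
  have hN : N ≠ 0 := by simp [N]
  have hN0 : 0 ≤ N⁻¹ := by positivity
  have hnn : ∀ j x, 0 ≤ 1 + u j x := fun j x => by linarith [(abs_le.1 (hb j x)).1]
  have hfi : ∀ j, Integrable (fun x => 1 + u j x) P₀ := fun j =>
    (integrable_const 1).add
      (Integrable.of_bound (hm j).aestronglyMeasurable 1 (ae_of_all _ (hb j)))
  have hLm : ∀ j, Measurable fun x : Fin n → X => ENNReal.ofReal (∏ i, (1 + u j (x i))) :=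
    fun j => ENNReal.measurable_ofReal.comp <| Finset.measurable_fun_prod _ fun i _ =>
      measurable_const.add ((hm j).comp (measurable_pi_apply i))
  have hpi : ∀ j, ∫⁻ x, (1 - φ x) ∂(Measure.pi fun _ : Fin n => (P j : Measure X)) =
      ∫⁻ x, ENNReal.ofReal (∏ i, (1 + u j (x i))) * (1 - φ x) ∂Q := by
    intro j
    have hs : SigmaFinite (P₀.withDensity fun x => ENNReal.ofReal (1 + u j x)) := by
      rw [← hPd j]; infer_instance
    have h1 : Measurable fun x => 1 - φ x := measurable_const.sub hφ.1
    rw [hPd j, pi_withDensity_ofReal P₀ (hnn j) (hfi j) n,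
      lintegral_withDensity_eq_lintegral_mul _ (hLm j) h1]
    rfl
  have hmix : ENNReal.ofReal N⁻¹ *
      ∑ j, ∫⁻ x, ENNReal.ofReal (∏ i, (1 + u j (x i))) * (1 - φ x) ∂Q ≤ typeII Alt φ := by
    calc _ ≤ ENNReal.ofReal N⁻¹ * ∑ _j : J, typeII Alt φ := by
          gcongr with j
          rw [← hpi j]
          exact le_iSup₂_of_le (P j) (hPA j) le_rfl
      _ = typeII Alt φ := by
          rw [Finset.sum_const, Finset.card_univ, nsmul_eq_mul, ← mul_assoc,
            ← ENNReal.ofReal_natCast, ← ENNReal.ofReal_mul hN0, inv_mul_cancel₀ hN,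
            ENNReal.ofReal_one, one_mul]
  -- With `A` the mixture, `A (1 - φ) ≥ (1 - φ) - |A - 1|` because `0 ≤ 1 - φ ≤ 1`.
  have hpt : ∀ x : Fin n → X, 1 ≤ φ x +
      ENNReal.ofReal N⁻¹ * ∑ j, ENNReal.ofReal (∏ i, (1 + u j (x i))) * (1 - φ x) +
      ENNReal.ofReal |N⁻¹ * ∑ j, ∏ i, (1 + u j (x i)) - 1| := by
    intro x
    have hpn : ∀ j, 0 ≤ ∏ i, (1 + u j (x i)) := fun j => Finset.prod_nonneg fun i _ => hnn j _
    set A := N⁻¹ * ∑ j, ∏ i, (1 + u j (x i)) with hA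
    have hA0 : 0 ≤ A := mul_nonneg hN0 (Finset.sum_nonneg fun j _ => hpn j)
    have hAe : ENNReal.ofReal N⁻¹ * ∑ j, ENNReal.ofReal (∏ i, (1 + u j (x i))) * (1 - φ x) =
        ENNReal.ofReal A * (1 - φ x) := by
      rw [← Finset.sum_mul, ← ENNReal.ofReal_sum_of_nonneg fun j _ => hpn j, ← mul_assoc,
        ← ENNReal.ofReal_mul hN0]
    rw [hAe]
    obtain ⟨t, ht0, ht1, ht⟩ : ∃ t : ℝ, 0 ≤ t ∧ t ≤ 1 ∧ φ x = ENNReal.ofReal t :=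
      ⟨(φ x).toReal, ENNReal.toReal_nonneg,
        ENNReal.toReal_le_of_le_ofReal zero_le_one (by simpa using hφ.2 x),
        (ENNReal.ofReal_toReal (ne_top_of_le_ne_top ENNReal.one_ne_top (hφ.2 x))).symm⟩
    rw [ht, ← ENNReal.ofReal_one, ← ENNReal.ofReal_sub _ ht0, ← ENNReal.ofReal_mul hA0,
      ← ENNReal.ofReal_add ht0 (mul_nonneg hA0 (by linarith)),
      ← ENNReal.ofReal_add (add_nonneg ht0 (mul_nonneg hA0 (by linarith))) (abs_nonneg _)]
    refine ENNReal.ofReal_le_ofReal ?_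
    nlinarith [neg_abs_le (A - 1), abs_nonneg (A - 1)]
  calc (1 : ℝ≥0∞) = ∫⁻ _, 1 ∂Q := by simp [hQ]
    _ ≤ ∫⁻ x, (φ x +
      ENNReal.ofReal N⁻¹ * ∑ j, ENNReal.ofReal (∏ i, (1 + u j (x i))) * (1 - φ x) +
      ENNReal.ofReal |N⁻¹ * ∑ j, ∏ i, (1 + u j (x i)) - 1|) ∂Q := lintegral_mono hpt
    _ = typeI P₀ φ + ENNReal.ofReal N⁻¹ *
          ∑ j, ∫⁻ x, ENNReal.ofReal (∏ i, (1 + u j (x i))) * (1 - φ x) ∂Q +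
        ENNReal.ofReal (∫ x, |N⁻¹ * ∑ j, ∏ i, (1 + u j (x i)) - 1| ∂Q) := by
      have hpm : ∀ j, Measurable fun x : Fin n → X =>
          ENNReal.ofReal (∏ i, (1 + u j (x i))) * (1 - φ x) := fun j =>
        (hLm j).mul (measurable_const.sub hφ.1)
      have hsm : Measurable fun x : Fin n → X =>
          ∑ j, ENNReal.ofReal (∏ i, (1 + u j (x i))) * (1 - φ x) :=
        Finset.measurable_fun_sum _ fun j _ => hpm j
      have hm1 : Measurable fun x : Fin n → X => φ x +
          ENNReal.ofReal N⁻¹ * ∑ j, ENNReal.ofReal (∏ i, (1 + u j (x i))) * (1 - φ x) :=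
        hφ.1.add (hsm.const_mul _)
      rw [lintegral_add_left hm1, lintegral_add_left hφ.1,
        lintegral_const_mul _ hsm, lintegral_finsetSum _ fun j _ => hpm j,
        ofReal_integral_eq_lintegral_ofReal hDi (ae_of_all _ fun x => abs_nonneg _)]
      rfl
    _ ≤ _ := by gcongr; exact hDle.trans hδ

/-- A lower bound on the sum of the two errors, with a vanishing remainder, rules out consistent
tests. -/
theorem noConsistentTest_of_forall_le {P₀ : Measure X} {Alt : ℕ → Set (ProbabilityMeasure X)}
    {α : ℝ} (h0 : 0 < α) (h1 : α < 1)
    (h : ∀ δ : ℝ, 0 < δ → ∀ᶠ n in atTop, ∀ φ : (Fin n → X) → ℝ≥0∞, IsTest φ →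
      1 ≤ typeI P₀ φ + typeII (Alt n) φ + ENNReal.ofReal δ) :
    NoConsistentTest P₀ Alt α := by
  -- One `η` is slack for the asymptotic level, one is the remainder, and one is the resulting lower
  -- bound on the type-II error; `α + 3η = 1 - η` is still below `1`.
  set η : ℝ := (1 - α) / 4 with hη
  have hη0 : 0 < η := by rw [hη]; linarith
  have key : ∀ {a b : ℝ≥0∞}, a ≤ ENNReal.ofReal (α + η) → 1 ≤ a + b + ENNReal.ofReal η →
      ENNReal.ofReal η ≤ b := by
    intro a b ha hb
    by_contra hlt
    rw [not_le] at hlt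
    have hb' : b ≠ ∞ := ne_top_of_lt hlt
    have h2 : a + b + ENNReal.ofReal η <
        ENNReal.ofReal (α + η) + ENNReal.ofReal η + ENNReal.ofReal η := by
      refine ENNReal.add_lt_add_right ENNReal.ofReal_ne_top ?_
      exact ENNReal.add_lt_add_of_le_of_lt (ne_top_of_le_ne_top ENNReal.ofReal_ne_top ha) ha hlt
    rw [← ENNReal.ofReal_add (by linarith) hη0.le, ← ENNReal.ofReal_add (by linarith) hη0.le] at h2
    have h3 : ENNReal.ofReal (α + η + η + η) ≤ 1 := by
      rw [← ENNReal.ofReal_one]; exact ENNReal.ofReal_le_ofReal (by rw [hη]; linarith)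
    exact absurd (hb.trans_lt (h2.trans_le h3)) (lt_irrefl _)
  have hpos : 0 < ENNReal.ofReal η := ENNReal.ofReal_pos.2 hη0
  constructor
  · refine hpos.trans_le (le_liminf_of_le (by isBoundedDefault) ?_)
    filter_upwards [h η hη0] with n hn
    refine le_iInf₂ fun φ hφ => key (hφ.2.trans ?_) (hn φ hφ.1)
    exact ENNReal.ofReal_le_ofReal (by linarith)
  · refine hpos.trans_le (le_iInf₂ fun φ hφ => le_liminf_of_le (by isBoundedDefault) ?_)
    have hlt : limsup (fun n => typeI P₀ (φ n)) atTop < ENNReal.ofReal (α + η) :=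
      hφ.2.trans_lt ((ENNReal.ofReal_lt_ofReal_iff (by linarith)).2 (by linarith))
    filter_upwards [h η hη0, eventually_lt_of_limsup_lt hlt] with n hn hl
    exact key hl.le (hn (φ n) (hφ.1 n))

end Mixture

/-! ### Orthonormality of the pointwise eigenfunctions -/

section Eigensystem

theorem norm_sq_sum_smul {ι E : Type*} [NormedAddCommGroup E] [InnerProductSpace ℝ E] {v : ι → E}
    (hv : Orthonormal ℝ v) (s : Finset ι) (a : ι → ℝ) :
    ‖∑ i ∈ s, a i • v i‖ ^ 2 = ∑ i ∈ s, a i ^ 2 := by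
  rw [← real_inner_self_eq_norm_sq, hv.inner_sum]
  exact Finset.sum_congr rfl fun i _ => by simp [sq]

variable {X : Type*} [MeasurableSpace X] {P₀ : Measure X} {K : X → X → ℝ} {eig : ℕ → ℝ}
  {e : ℕ → Lp ℝ 2 P₀}

theorem inner_lp_eq_integral (f g : Lp ℝ 2 P₀) : ⟪f, g⟫ = ∫ x, f x * g x ∂P₀ := by
  rw [L2.inner_def]
  refine integral_congr_ae (ae_of_all _ fun x => ?_)
  simp [mul_comm]

theorem eigenfunction_ae_eq (he : IsEigensystem K P₀ eig e) (i : ℕ) :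
    eigenfunction K P₀ eig e i =ᵐ[P₀] e i := by
  filter_upwards [he.eigen i] with x hx
  rw [eigenfunction, hx, inv_mul_cancel_left₀ (he.pos i).ne']

theorem integral_eigenfunction_mul (he : IsEigensystem K P₀ eig e) (i j : ℕ) :
    ∫ x, eigenfunction K P₀ eig e i x * eigenfunction K P₀ eig e j x ∂P₀ =
      if i = j then 1 else 0 := by
  rw [← orthonormal_iff_ite.1 he.orthonormal i j, inner_lp_eq_integral]
  exact integral_congr_ae ((eigenfunction_ae_eq he i).mul (eigenfunction_ae_eq he j))

theorem memLp_eigenfunction (he : IsEigensystem K P₀ eig e) (i : ℕ) :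
    MemLp (eigenfunction K P₀ eig e i) 2 P₀ :=
  (memLp_congr_ae (eigenfunction_ae_eq he i)).2 (Lp.memLp _)

theorem integrable_eigenfunction_mul (he : IsEigensystem K P₀ eig e) (i j : ℕ) :
    Integrable (fun x => eigenfunction K P₀ eig e i x * eigenfunction K P₀ eig e j x) P₀ :=
  (memLp_eigenfunction he i).integrable_mul (memLp_eigenfunction he j)

/-- Only common indices survive orthonormality. The two index sets may differ because the one-index
family has disjoint supports, while the sign family shares one support. -/
theorem integral_sum_mul_sum_eigenfunction (he : IsEigensystem K P₀ eig e)
    (s t : Finset ℕ) (a b : ℕ → ℝ) :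
    ∫ x, (∑ i ∈ s, a i * eigenfunction K P₀ eig e i x) *
      (∑ j ∈ t, b j * eigenfunction K P₀ eig e j x) ∂P₀ = ∑ i ∈ s ∩ t, a i * b i := by
  have h1 : ∀ i j, Integrable (fun x => a i * eigenfunction K P₀ eig e i x *
      (b j * eigenfunction K P₀ eig e j x)) P₀ := fun i j => by
    refine ((integrable_eigenfunction_mul he i j).const_mul (a i * b j)).congr
      (ae_of_all _ fun x => ?_)
    simp only; ring
  have h2 : ∀ i j, ∫ x, a i * eigenfunction K P₀ eig e i x *
      (b j * eigenfunction K P₀ eig e j x) ∂P₀ = if i = j then a i * b i else 0 := fun i j => by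
    have : ∀ x, a i * eigenfunction K P₀ eig e i x * (b j * eigenfunction K P₀ eig e j x) =
      (a i * b j) * (eigenfunction K P₀ eig e i x * eigenfunction K P₀ eig e j x) :=
      fun x => by ring
    simp only [this]
    rw [integral_const_mul, integral_eigenfunction_mul he]
    split_ifs with h <;> simp [h]
  simp only [Finset.sum_mul_sum]
  rw [integral_finsetSum _ fun i _ => integrable_finsetSum _ fun j _ => h1 i j]
  have h3 : ∀ i, ∫ x, ∑ j ∈ t, a i * eigenfunction K P₀ eig e i x *
      (b j * eigenfunction K P₀ eig e j x) ∂P₀ = if i ∈ t then a i * b i else 0 := fun i => by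
    rw [integral_finsetSum _ fun j _ => h1 i j]
    simp [h2]
  simp only [h3]
  rw [Finset.sum_ite_mem]

/-- Finite combinations of eigenfunctions lie in the range of every power. -/
theorem sum_smul_mem_powRange (he : IsEigensystem K P₀ eig e) (θ : ℝ)
    (s : Finset ℕ) (a : ℕ → ℝ) : ∑ i ∈ s, a i • e i ∈ powRange eig e θ := by
  refine ⟨∑ i ∈ s, (a i * (eig i ^ θ)⁻¹) • e i, ?_⟩
  have hin : ∀ i, ⟪e i, ∑ j ∈ s, (a j * (eig j ^ θ)⁻¹) • e j⟫ =
      if i ∈ s then a i * (eig i ^ θ)⁻¹ else 0 := fun i => by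
    simp [inner_sum, inner_smul_right, orthonormal_iff_ite.1 he.orthonormal]
  have hs : ∑ i ∈ s, a i • e i =
      ∑ i ∈ s, (eig i ^ θ * ⟪e i, ∑ j ∈ s, (a j * (eig j ^ θ)⁻¹) • e j⟫) • e i := by
    refine Finset.sum_congr rfl fun i hi => ?_
    have := (Real.rpow_pos_of_pos (he.pos i) θ).ne'
    rw [hin, if_pos hi]
    congr 1
    field_simp
  rw [hs]
  refine hasSum_sum_of_ne_finset_zero fun i hi => ?_
  rw [hin, if_neg hi, mul_zero, zero_smul]

end Eigensystem

/-! ### The feature map, its embedding, and perturbations of `P₀` -/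

section Operator

variable {X : Type*} [TopologicalSpace X] [MeasurableSpace X]
  {H : Type*} [NormedAddCommGroup H] [InnerProductSpace ℝ H]
  {P₀ : Measure X} {ψ : X → H}

/-- Expanding the square, `‖ψ x - ψ x₀‖² = K(x, x) - 2 K(x, x₀) + K(x₀, x₀)`, which tends to `0` at
`x₀`. -/
theorem SteinAssumptions.continuous (hψ : SteinAssumptions ψ P₀) : Continuous ψ := by
  have hK := hψ.continuous_kernel
  rw [continuous_iff_continuousAt]
  intro x₀
  rw [ContinuousAt, tendsto_iff_norm_sub_tendsto_zero]
  have h1 : Continuous fun x => steinKernel ψ x x - 2 * steinKernel ψ x x₀ + steinKernel ψ x₀ x₀ :=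
    ((hK.comp (continuous_id.prodMk continuous_id)).sub
      (continuous_const.mul (hK.comp (continuous_id.prodMk continuous_const)))).add
      continuous_const
  have h2 : (fun x => ‖ψ x - ψ x₀‖) =
      fun x => √(steinKernel ψ x x - 2 * steinKernel ψ x x₀ + steinKernel ψ x₀ x₀) := by
    ext x
    simp only [steinKernel, real_inner_self_eq_norm_sq]
    rw [← norm_sub_sq_real, Real.sqrt_sq (norm_nonneg _)]
  rw [h2]
  have h3 := (Real.continuous_sqrt.comp h1).tendsto x₀
  have h4 : steinKernel ψ x₀ x₀ - 2 * steinKernel ψ x₀ x₀ + steinKernel ψ x₀ x₀ = 0 := by ring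
  simpa only [Function.comp_def, h4, Real.sqrt_zero] using h3

variable [SecondCountableTopology X] [BorelSpace X]

theorem SteinAssumptions.memLp (hψ : SteinAssumptions ψ P₀) : MemLp ψ 2 P₀ := by
  rw [memLp_two_iff_integrable_sq_norm hψ.continuous.stronglyMeasurable.aestronglyMeasurable]
  simpa only [steinKernel, real_inner_self_eq_norm_sq] using hψ.integrable_diag

/-- The adjoint `f ↦ ∫ f ψ dP₀` of `h ↦ ⟪ψ ·, h⟫`. -/
def meanEmbedding (ψ : X → H) (P₀ : Measure X) (f : X → ℝ) : H :=
  ∫ y, f y • ψ y ∂P₀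

theorem SteinAssumptions.integrable_smul (hψ : SteinAssumptions ψ P₀) (f : Lp ℝ 2 P₀) :
    Integrable (fun y => f y • ψ y) P₀ :=
  memLp_one_iff_integrable.1 (MemLp.smul (r := 1) hψ.memLp (Lp.memLp f))

variable {eig : ℕ → ℝ} {e : ℕ → Lp ℝ 2 P₀}

/-- If the rows of the kernel are bounded in `L²`, a finite combination of eigenfunctions is bounded
in terms of its coefficients. -/
theorem abs_sum_eigenfunction_le (hψ : SteinAssumptions ψ P₀)
    (he : IsEigensystem (steinKernel ψ) P₀ eig e) {M : ℝ} (hM0 : 0 ≤ M)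
    (hM : ∀ x, ∫⁻ y, ENNReal.ofReal (steinKernel ψ x y ^ 2) ∂P₀ ≤ ENNReal.ofReal M)
    (s : Finset ℕ) (a : ℕ → ℝ) (x : X) :
    |∑ i ∈ s, a i * eigenfunction (steinKernel ψ) P₀ eig e i x| ≤
      √(M * ∑ i ∈ s, (a i / eig i) ^ 2) := by
  have hk : MemLp (fun y => steinKernel ψ x y) 2 P₀ := hψ.memLp.const_inner (ψ x)
  have hknorm : ‖hk.toLp _‖ ^ 2 ≤ M := by
    rw [← real_inner_self_eq_norm_sq, inner_lp_eq_integral]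
    have h1 : ∫ y, hk.toLp _ y * hk.toLp _ y ∂P₀ = ∫ y, steinKernel ψ x y ^ 2 ∂P₀ :=
      integral_congr_ae (by filter_upwards [hk.coeFn_toLp] with y hy; rw [hy, sq])
    rw [h1, ← ENNReal.ofReal_le_ofReal_iff hM0,
      ofReal_integral_eq_lintegral_ofReal hk.integrable_sq (ae_of_all _ fun _ => sq_nonneg _)]
    exact hM x
  have hin : ∀ f : Lp ℝ 2 P₀, integralOp (steinKernel ψ) P₀ f x = ⟪hk.toLp _, f⟫ := fun f => by
    rw [inner_lp_eq_integral, integralOp]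
    exact integral_congr_ae (by filter_upwards [hk.coeFn_toLp] with y hy; rw [hy])
  -- Since `φ_i(x) = λ_i⁻¹ ⟪K(x, ·), e i⟫`, the combination at `x` is `⟪K(x, ·), w⟫`, to be bounded
  -- by Cauchy-Schwarz.
  set w : Lp ℝ 2 P₀ := ∑ i ∈ s, (a i / eig i) • e i with hw
  have hsum : ∑ i ∈ s, a i * eigenfunction (steinKernel ψ) P₀ eig e i x = ⟪hk.toLp _, w⟫ := by
    rw [hw, inner_sum]
    refine Finset.sum_congr rfl fun i _ => ?_
    rw [eigenfunction, hin, inner_smul_right, div_eq_mul_inv, mul_assoc]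
  have hwn : ‖w‖ ^ 2 = ∑ i ∈ s, (a i / eig i) ^ 2 :=
    norm_sq_sum_smul he.orthonormal s _
  rw [hsum, ← hwn]
  refine Real.le_sqrt_of_sq_le ?_
  calc |⟪hk.toLp _, w⟫| ^ 2 ≤ (‖hk.toLp _‖ * ‖w‖) ^ 2 := by
        gcongr; exact abs_real_inner_le_norm _ _
    _ = ‖hk.toLp _‖ ^ 2 * ‖w‖ ^ 2 := mul_pow _ _ _
    _ ≤ M * ‖w‖ ^ 2 := by gcongr

variable [CompleteSpace H]

/-- The integral passes inside the inner product. This makes the eigenfunctions coordinates of `ψ`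
at every point, hence continuous. -/
theorem integralOp_eq_inner (hψ : SteinAssumptions ψ P₀) (f : Lp ℝ 2 P₀) (x : X) :
    integralOp (steinKernel ψ) P₀ f x = ⟪ψ x, meanEmbedding ψ P₀ f⟫ := by
  rw [meanEmbedding, ← integral_inner (hψ.integrable_smul f)]
  refine integral_congr_ae (ae_of_all _ fun y => ?_)
  simp only [steinKernel, inner_smul_right, mul_comm]

theorem integral_inner_mul (hψ : SteinAssumptions ψ P₀) (f : Lp ℝ 2 P₀) (h : H) :
    ∫ x, ⟪ψ x, h⟫ * f x ∂P₀ = ⟪h, meanEmbedding ψ P₀ f⟫ := by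
  rw [meanEmbedding, ← integral_inner (hψ.integrable_smul f)]
  refine integral_congr_ae (ae_of_all _ fun y => ?_)
  simp only [inner_smul_right, real_inner_comm h, mul_comm]

theorem continuous_eigenfunction (hψ : SteinAssumptions ψ P₀) (i : ℕ) :
    Continuous (eigenfunction (steinKernel ψ) P₀ eig e i) := by
  have : eigenfunction (steinKernel ψ) P₀ eig e i =
      fun x => (eig i)⁻¹ * ⟪ψ x, meanEmbedding ψ P₀ (e i)⟫ := by
    ext x; rw [eigenfunction, integralOp_eq_inner hψ]
  rw [this]
  exact continuous_const.mul (hψ.continuous.inner continuous_const)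

theorem eig_mul_eigenfunction (hψ : SteinAssumptions ψ P₀)
    (he : IsEigensystem (steinKernel ψ) P₀ eig e) (i : ℕ) (x : X) :
    eig i * eigenfunction (steinKernel ψ) P₀ eig e i x = ⟪ψ x, meanEmbedding ψ P₀ (e i)⟫ := by
  rw [eigenfunction, mul_inv_cancel_left₀ (he.pos i).ne', integralOp_eq_inner hψ]

/-- Each eigenfunction is `⟪ψ ·, h⟫` for a fixed `h`, so the Stein identity annihilates its mean. -/
theorem integral_eigenfunction [IsFiniteMeasure P₀] (hψ : SteinAssumptions ψ P₀) (i : ℕ) :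
    ∫ x, eigenfunction (steinKernel ψ) P₀ eig e i x ∂P₀ = 0 := by
  simp only [eigenfunction, integralOp_eq_inner hψ]
  rw [integral_const_mul]
  simp only [real_inner_comm (meanEmbedding ψ P₀ (e i))]
  rw [integral_inner (hψ.memLp.integrable one_le_two), hψ.stein_identity, inner_zero_right,
    mul_zero]

/-- A finite combination of eigenfunctions that is bounded by `1` perturbs `P₀` to an alternative. -/
theorem exists_mem_alternatives [IsProbabilityMeasure P₀] (hψ : SteinAssumptions ψ P₀)
    (he : IsEigensystem (steinKernel ψ) P₀ eig e) {c κ θ Δ : ℝ}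
    (hM : MomentBound (steinKernel ψ) c κ P₀) (s : Finset ℕ) (a : ℕ → ℝ)
    (hb : ∀ x, |∑ i ∈ s, a i * eigenfunction (steinKernel ψ) P₀ eig e i x| ≤ 1)
    (hΔ : Δ ≤ ∑ i ∈ s, a i ^ 2) :
    ∃ P ∈ alternatives (steinKernel ψ) P₀ eig e (2 * c) κ θ Δ, (P : Measure X) =
      P₀.withDensity fun x => ENNReal.ofReal
        (1 + ∑ i ∈ s, a i * eigenfunction (steinKernel ψ) P₀ eig e i x) := by
  set u : X → ℝ := fun x => ∑ i ∈ s, a i * eigenfunction (steinKernel ψ) P₀ eig e i x with hu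
  have hum : Measurable u := Finset.measurable_fun_sum _ fun i _ =>
    measurable_const.mul (continuous_eigenfunction hψ i).measurable
  have hfm : Measurable fun x => ENNReal.ofReal (1 + u x) :=
    ENNReal.measurable_ofReal.comp (measurable_const.add hum)
  have hnn : ∀ x, 0 ≤ 1 + u x := fun x => by linarith [(abs_le.1 (hb x)).1]
  have hle : ∀ x, ENNReal.ofReal (1 + u x) ≤ 2 := fun x => by
    rw [← ENNReal.ofReal_ofNat]
    exact ENNReal.ofReal_le_ofReal (by linarith [(abs_le.1 (hb x)).2])
  have hui : Integrable u P₀ := Integrable.of_bound hum.aestronglyMeasurable 1 (ae_of_all _ hb)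
  have hu0 : ∫ x, u x ∂P₀ = 0 := by
    simp only [hu]
    rw [integral_finsetSum _ fun i _ =>
      ((memLp_eigenfunction he i).integrable one_le_two).const_mul _]
    simp [integral_const_mul, integral_eigenfunction hψ]
  have hprob : IsProbabilityMeasure (P₀.withDensity fun x => ENNReal.ofReal (1 + u x)) := by
    refine ⟨?_⟩
    have h1 : Integrable (fun x => 1 + u x) P₀ := (integrable_const 1).add hui
    rw [withDensity_apply _ MeasurableSet.univ, Measure.restrict_univ,
      ← ofReal_integral_eq_lintegral_ofReal h1 (ae_of_all _ hnn),
      integral_add (integrable_const 1) hui, hu0]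
    simp
  -- A density bounded by `2` at most doubles every moment; this is the origin of `2 * c`.
  have hlint : ∀ g : X → ℝ≥0∞, Measurable g →
      ∫⁻ x, g x ∂(P₀.withDensity fun x => ENNReal.ofReal (1 + u x)) ≤ 2 * ∫⁻ x, g x ∂P₀ := by
    intro g hg
    rw [lintegral_withDensity_eq_lintegral_mul _ hfm hg, ← lintegral_const_mul _ hg]
    exact lintegral_mono fun x => mul_le_mul_left (hle x) _
  have hKm : Measurable fun x => steinKernel ψ x x :=
    (hψ.continuous_kernel.comp (continuous_id.prodMk continuous_id)).measurable
  refine ⟨⟨_, hprob⟩, ⟨⟨fun r hr => ?_, ?_⟩, withDensity_absolutelyContinuous _ _,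
    ∑ i ∈ s, a i • e i, ?_, sum_smul_mem_powRange he θ s a, ?_⟩, rfl⟩
  · refine (hlint _ (ENNReal.measurable_ofReal.comp (hKm.pow_const r))).trans ?_
    calc _ ≤ 2 * ENNReal.ofReal (c * r.factorial * κ ^ r) := by gcongr; exact hM r hr
      _ = ENNReal.ofReal (2 * c * r.factorial * κ ^ r) := by
        rw [← ENNReal.ofReal_ofNat, ← ENNReal.ofReal_mul (by norm_num)]
        congr 1; ring
  · refine (hlint _ (ENNReal.measurable_ofReal.comp hKm)).trans_lt ?_
    refine ENNReal.mul_lt_top (by norm_num) ?_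
    exact hψ.integrable_diag.lintegral_lt_top
  · have h1 : (∑ i ∈ s, a i • e i : Lp ℝ 2 P₀) =ᵐ[P₀] u := by
      have h2 : ∀ i ∈ s, (a i • e i : Lp ℝ 2 P₀) =ᵐ[P₀]
          fun x => a i * eigenfunction (steinKernel ψ) P₀ eig e i x := fun i _ => by
        filter_upwards [Lp.coeFn_smul (a i) (e i), eigenfunction_ae_eq he i] with x hx hx'
        rw [hx, Pi.smul_apply, smul_eq_mul, hx']
      filter_upwards [Lp.coeFn_finsetSum s fun i => a i • e i,
        (Finset.eventually_all s).2 h2] with x hx hx'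
      rw [hx, Finset.sum_apply]
      exact Finset.sum_congr rfl hx'
    filter_upwards [h1, Measure.rnDeriv_withDensity P₀ hfm] with x hx hx'
    change _ = ((P₀.withDensity fun x => ENNReal.ofReal (1 + u x)).rnDeriv P₀ x).toReal - 1
    rw [hx, hx', ENNReal.toReal_ofReal (hnn x)]
    ring
  · rwa [norm_sq_sum_smul he.orthonormal]

end Operator

/-! ### Almost sure boundedness of the kernel diagonal -/

section Mercer

variable {X : Type*} [TopologicalSpace X] [SecondCountableTopology X] [MeasurableSpace X]
  [BorelSpace X] {H : Type*} [NormedAddCommGroup H] [InnerProductSpace ℝ H] [CompleteSpace H]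
  {P₀ : Measure X} {ψ : X → H} {eig : ℕ → ℝ} {e : ℕ → Lp ℝ 2 P₀}

/-- By adjointness the left side is `∫ λ_i φ_i e_j`. Hence the embeddings become orthonormal after
division by `√λ_i`. -/
theorem inner_meanEmbedding (hψ : SteinAssumptions ψ P₀)
    (he : IsEigensystem (steinKernel ψ) P₀ eig e) (i j : ℕ) :
    ⟪meanEmbedding ψ P₀ (e i), meanEmbedding ψ P₀ (e j)⟫ = if i = j then eig i else 0 := by
  rw [← integral_inner_mul hψ]
  simp only [← eig_mul_eigenfunction hψ he i, mul_assoc]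
  have h1 : ∫ x, eigenfunction (steinKernel ψ) P₀ eig e i x * e j x ∂P₀ =
      if i = j then 1 else 0 := by
    rw [← integral_eigenfunction_mul he i j]
    exact integral_congr_ae ((ae_eq_refl _).mul (eigenfunction_ae_eq he j).symm)
  rw [integral_const_mul, h1, mul_ite, mul_one, mul_zero]

/-- A direction orthogonal to all `∫ eᵢ ψ dP₀` is almost surely orthogonal to `ψ`. -/
theorem inner_ae_eq_zero (hψ : SteinAssumptions ψ P₀)
    (he : IsEigensystem (steinKernel ψ) P₀ eig e) {h : H}
    (hh : ∀ i, ⟪h, meanEmbedding ψ P₀ (e i)⟫ = 0) : (fun x => ⟪ψ x, h⟫) =ᵐ[P₀] 0 := by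
  have hg : MemLp (fun x => ⟪ψ x, h⟫) 2 P₀ := hψ.memLp.inner_const h
  set g : Lp ℝ 2 P₀ := hg.toLp _ with hgdef
  have hgin : ∀ f : Lp ℝ 2 P₀, ⟪g, f⟫ = ⟪h, meanEmbedding ψ P₀ f⟫ := fun f => by
    rw [← integral_inner_mul hψ, inner_lp_eq_integral]
    exact integral_congr_ae (by filter_upwards [hg.coeFn_toLp] with y hy; rw [hy])
  -- Orthogonality to every `e i` extends to the closure of the range by completeness of the
  -- eigensystem.
  have hspan : closure (integralOpRange (steinKernel ψ) P₀) ⊆ {f | ⟪g, f⟫ = 0} := by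
    rw [← he.complete]
    refine closure_minimal ?_ (isClosed_eq (continuous_const.inner continuous_id) continuous_const)
    intro f hf
    refine Submodule.span_induction ?_ ?_ ?_ ?_ hf
    · rintro _ ⟨i, rfl⟩
      exact (hgin _).trans (hh i)
    · simp
    · intro a b _ _ ha hb
      simp only [Set.mem_ofPred_eq] at ha hb ⊢
      rw [inner_add_right, ha, hb, add_zero]
    · intro r a _ ha
      simp only [Set.mem_ofPred_eq] at ha ⊢
      rw [inner_smul_right, ha, mul_zero]
  -- Test against `Υ g`, which is in the range: `0 = ⟪g, Υ g⟫` is the squared norm of the embedding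
  -- of `g`. That embedding therefore vanishes, and `⟪g, g⟫`, its product with `h`, does too.
  have hT : MemLp (fun x => ⟪ψ x, meanEmbedding ψ P₀ g⟫) 2 P₀ := hψ.memLp.inner_const _
  have hmem : hT.toLp _ ∈ integralOpRange (steinKernel ψ) P₀ := by
    refine ⟨g, ?_⟩
    filter_upwards [hT.coeFn_toLp] with x hx
    rw [hx, integralOp_eq_inner hψ]
  have h1 : ⟪g, hT.toLp _⟫ = 0 := hspan (subset_closure hmem)
  have h2 : ⟪g, hT.toLp _⟫ = ⟪meanEmbedding ψ P₀ g, meanEmbedding ψ P₀ g⟫ := by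
    rw [← integral_inner_mul hψ, real_inner_comm, inner_lp_eq_integral]
    exact integral_congr_ae (by filter_upwards [hT.coeFn_toLp] with y hy; rw [hy])
  have h3 : meanEmbedding ψ P₀ g = 0 := inner_self_eq_zero.1 (h2.symm.trans h1)
  have h4 : g = 0 := inner_self_eq_zero.1 (by rw [hgin, h3, inner_zero_right] : ⟪g, g⟫ = 0)
  have h5 := hg.coeFn_toLp
  rw [← hgdef, h4] at h5
  exact h5.symm.trans (Lp.coeFn_zero ℝ 2 P₀)

/-- Bounded eigenfunctions make the diagonal of the kernel almost surely bounded. -/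
theorem exists_ae_diag_le (hψ : SteinAssumptions ψ P₀)
    (he : IsEigensystem (steinKernel ψ) P₀ eig e)
    (hb : EigenfunctionsBounded (steinKernel ψ) P₀ eig e) :
    ∃ C : ℝ, ∀ᵐ x ∂P₀, steinKernel ψ x x ≤ C := by
  obtain ⟨M, hM⟩ := hb
  set b : ℕ → H := fun i => (√(eig i))⁻¹ • meanEmbedding ψ P₀ (e i) with hbdef
  have hsq : ∀ i, √(eig i) ≠ 0 := fun i => (Real.sqrt_pos.2 (he.pos i)).ne'
  have hbo : Orthonormal ℝ b := by
    rw [orthonormal_iff_ite]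
    intro i j
    simp only [hbdef, inner_smul_left, inner_smul_right, inner_meanEmbedding hψ he]
    split_ifs with h
    · subst h
      have h1 := Real.mul_self_sqrt (he.pos i).le
      have h2 := hsq i
      simp only [conj_trivial]
      nth_rewrite 3 [← h1]
      field_simp
    · simp
  have hbψ : ∀ i x, ⟪b i, ψ x⟫ = √(eig i) * eigenfunction (steinKernel ψ) P₀ eig e i x := by
    intro i x
    have h1 := Real.mul_self_sqrt (he.pos i).le
    have h2 := hsq i
    simp only [hbdef]
    rw [real_inner_comm, inner_smul_right, ← eig_mul_eigenfunction hψ he]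
    nth_rewrite 2 [← h1]
    field_simp
  have hbsq : ∀ i x, ‖⟪b i, ψ x⟫‖ ^ 2 =
      eig i * (eigenfunction (steinKernel ψ) P₀ eig e i x *
        eigenfunction (steinKernel ψ) P₀ eig e i x) := by
    intro i x
    rw [hbψ, Real.norm_eq_abs, sq_abs, mul_pow, Real.sq_sqrt (he.pos i).le, sq]
  -- Bessel's inequality for `ψ x`, integrated over `x`.
  have htrace : ∀ s : Finset ℕ, ∑ i ∈ s, eig i ≤ ∫ x, steinKernel ψ x x ∂P₀ := by
    intro s
    have h1 : ∑ i ∈ s, eig i = ∫ x, ∑ i ∈ s, ‖⟪b i, ψ x⟫‖ ^ 2 ∂P₀ := by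
      simp only [hbsq]
      rw [integral_finsetSum _ fun i _ => (integrable_eigenfunction_mul he i i).const_mul _]
      simp [integral_const_mul, integral_eigenfunction_mul he]
    rw [h1]
    refine integral_mono ?_ hψ.integrable_diag fun x => ?_
    · simp only [hbsq]
      exact integrable_finsetSum _ fun i _ => (integrable_eigenfunction_mul he i i).const_mul _
    · rw [steinKernel, real_inner_self_eq_norm_sq]
      exact hbo.sum_inner_products_le (ψ x)
  set S := ∫ x, steinKernel ψ x x ∂P₀
  have hS : 0 ≤ S := by simpa using htrace ∅
  have hpart : ∀ (s : Finset ℕ) x, ∑ i ∈ s, ⟪b i, ψ x⟫ ^ 2 ≤ M ^ 2 * S := by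
    intro s x
    calc ∑ i ∈ s, ⟪b i, ψ x⟫ ^ 2 ≤ ∑ i ∈ s, eig i * M ^ 2 := by
          refine Finset.sum_le_sum fun i _ => ?_
          rw [hbψ, mul_pow, Real.sq_sqrt (he.pos i).le]
          have := (he.pos i).le
          gcongr ?_ * ?_
          exact sq_le_sq' (abs_le.1 (hM i x)).1 (abs_le.1 (hM i x)).2
      _ ≤ M ^ 2 * S := by
          rw [← Finset.sum_mul, mul_comm]
          gcongr
          exact htrace s
  -- The bound on coefficient sums bounds the functional `⟪ψ x, ·⟫` on `V`; evaluating it at `ψ x`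
  -- itself, once `ψ x ∈ V`, bounds `‖ψ x‖`.
  set V : Submodule ℝ H := (Submodule.span ℝ (Set.range b)).topologicalClosure
  have hV : ∀ x, ∀ v ∈ V, ⟪ψ x, v⟫ ≤ √(M ^ 2 * S) * ‖v‖ := by
    intro x
    have hcl : IsClosed {v : H | ⟪ψ x, v⟫ ≤ √(M ^ 2 * S) * ‖v‖} :=
      isClosed_le (continuous_const.inner continuous_id) (continuous_const.mul continuous_norm)
    intro v hv
    refine closure_minimal ?_ hcl hv
    intro w hw
    obtain ⟨a, rfl⟩ := (Finsupp.mem_span_range_iff_exists_finsupp).1 hw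
    have hn : ‖a.sum fun i r => r • b i‖ = √(∑ i ∈ a.support, a i ^ 2) := by
      rw [← Real.sqrt_sq (norm_nonneg (a.sum fun i r => r • b i)), Finsupp.sum,
        norm_sq_sum_smul hbo]
    have hi : ⟪ψ x, a.sum fun i r => r • b i⟫ = ∑ i ∈ a.support, ⟪b i, ψ x⟫ * a i := by
      rw [Finsupp.sum, inner_sum]
      refine Finset.sum_congr rfl fun i _ => ?_
      rw [inner_smul_right, real_inner_comm, mul_comm]
    simp only [Set.mem_ofPred_eq]
    rw [hn, hi]
    refine (Real.sum_mul_le_sqrt_mul_sqrt _ _ _).trans ?_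
    gcongr
    exact hpart _ x
  -- `H` need not be separable, but the range of a continuous map on a second countable space is, so
  -- testing against each functional separately suffices. Self-adjointness moves the projection onto
  -- the functional's representative `h`, leaving a vector orthogonal to `V`.
  have hres : (fun x => ψ x - V.starProjection (ψ x)) =ᵐ[P₀] 0 := by
    have hc : Continuous fun x => ψ x - V.starProjection (ψ x) :=
      hψ.continuous.sub (V.starProjection.continuous.comp hψ.continuous)
    refine ae_eq_zero_of_forall_dual_of_isSeparable ℝ
      (TopologicalSpace.isSeparable_range hc) (fun l => ?_)
      (ae_of_all _ fun x => Set.mem_range_self x)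
    set h : H := (InnerProductSpace.toDual ℝ H).symm l
    have hl : ∀ y, l y = ⟪h, y⟫ := fun y => (InnerProductSpace.toDual_symm_apply).symm
    have h1 := inner_ae_eq_zero hψ he (h := h - V.starProjection h) fun i => by
      have hmem : meanEmbedding ψ P₀ (e i) ∈ V := by
        have : meanEmbedding ψ P₀ (e i) = √(eig i) • b i := by
          simp only [hbdef]; rw [smul_inv_smul₀ (hsq i)]
        rw [this]
        exact V.smul_mem _ (Submodule.le_topologicalClosure _ (Submodule.subset_span ⟨i, rfl⟩))
      rw [real_inner_comm]
      exact Submodule.inner_right_of_mem_orthogonal hmem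
        (Submodule.sub_starProjection_mem_orthogonal h)
    filter_upwards [h1] with x hx
    change l (ψ x - V.starProjection (ψ x)) = 0
    rw [hl, inner_sub_right, ← Submodule.inner_starProjection_left_eq_right, ← inner_sub_left,
      real_inner_comm]
    exact hx
  refine ⟨M ^ 2 * S, ?_⟩
  filter_upwards [hres] with x hx
  have hxV : ψ x ∈ V := by
    rw [sub_eq_zero.1 hx]; exact Submodule.starProjection_apply_mem V _
  have h1 := hV x _ hxV
  rw [real_inner_self_eq_norm_mul_norm] at h1
  rw [steinKernel, real_inner_self_eq_norm_sq]
  have hMS : 0 ≤ M ^ 2 * S := by positivity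
  rcases (norm_nonneg (ψ x)).eq_or_lt with h0 | h0
  · rw [← h0]; simpa using hMS
  · exact (Real.le_sqrt (norm_nonneg _) hMS).1 (le_of_mul_le_mul_right h1 h0)

theorem exists_momentBound_of_eigenfunctionsBounded [IsProbabilityMeasure P₀]
    (hψ : SteinAssumptions ψ P₀) (he : IsEigensystem (steinKernel ψ) P₀ eig e)
    (hb : EigenfunctionsBounded (steinKernel ψ) P₀ eig e) :
    ∃ c κ : ℝ, 0 < c ∧ 0 < κ ∧ MomentBound (steinKernel ψ) c κ P₀ := by
  obtain ⟨C, hC⟩ := exists_ae_diag_le hψ he hb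
  -- A bounded diagonal has geometrically growing moments; the factorial is only used through `r! ≥
  -- 1`.
  refine ⟨1, max C 1, one_pos, lt_max_of_lt_right one_pos, fun r _ => ?_⟩
  calc ∫⁻ x, ENNReal.ofReal (steinKernel ψ x x ^ r) ∂P₀
      ≤ ∫⁻ _, ENNReal.ofReal (1 * r.factorial * max C 1 ^ r) ∂P₀ := by
        refine lintegral_mono_ae ?_
        filter_upwards [hC] with x hx
        refine ENNReal.ofReal_le_ofReal ?_
        have h0 : 0 ≤ steinKernel ψ x x := real_inner_self_nonneg
        have h1 : (1 : ℝ) ≤ r.factorial := by exact_mod_cast r.factorial_pos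
        have h2 : steinKernel ψ x x ^ r ≤ max C 1 ^ r :=
          pow_le_pow_left₀ h0 (hx.trans (le_max_left _ _)) r
        have h3 : (0 : ℝ) ≤ max C 1 ^ r := by positivity
        nlinarith
    _ = _ := by simp

end Mercer

/-! ### Random signs -/

section Signs

/-- The sign attached to a Boolean. -/
def boolSign (b : Bool) : ℝ := if b then 1 else -1

theorem boolSign_sq (b : Bool) : boolSign b ^ 2 = 1 := by cases b <;> simp [boolSign]

/-- The exponential moment of the correlation of two independent uniform sign vectors. -/
theorem signs_exp_moment_le (B : ℕ) (x : ℝ) :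
    (Fintype.card (Fin B → Bool) : ℝ)⁻¹ ^ 2 * ∑ ε : Fin B → Bool, ∑ η : Fin B → Bool,
      Real.exp (∑ i, x * (boolSign (ε i) * boolSign (η i))) ≤ Real.exp (B * (x ^ 2 / 2)) := by
  -- The sum over `η` factors over coordinates, and each factor is `2 cosh x` whatever the sign of
  -- `ε i`.
  have h1 : ∀ ε : Fin B → Bool, ∑ η : Fin B → Bool,
      Real.exp (∑ i, x * (boolSign (ε i) * boolSign (η i))) = (2 * Real.cosh x) ^ B := by
    intro ε
    simp only [Real.exp_sum]
    rw [← Fintype.piFinset_univ,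
      ← Finset.prod_univ_sum (fun _ => Finset.univ)
        (fun i b => Real.exp (x * (boolSign (ε i) * boolSign b)))]
    have h2 : ∀ i, ∑ b : Bool, Real.exp (x * (boolSign (ε i) * boolSign b)) =
        2 * Real.cosh x := fun i => by
      rw [Fintype.sum_bool, Real.cosh_eq]
      cases ε i <;> simp [boolSign] <;> ring
    rw [Finset.prod_congr rfl fun i _ => h2 i]
    simp
  simp only [h1, Finset.sum_const, Finset.card_univ, nsmul_eq_mul]
  have hc : (Fintype.card (Fin B → Bool) : ℝ) = 2 ^ B := by simp
  rw [hc, mul_pow]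
  have h2 : (2 : ℝ) ^ B ≠ 0 := by positivity
  calc _ = Real.cosh x ^ B := by field_simp
    _ ≤ Real.exp (x ^ 2 / 2) ^ B :=
        pow_le_pow_left₀ (Real.cosh_pos x).le (Real.cosh_le_exp_half_sq x) B
    _ = _ := by rw [← Real.exp_nat_mul]

end Signs

/-! ### The two undetectable families -/

section LowerBounds

variable {X : Type*} [TopologicalSpace X] [SecondCountableTopology X] [MeasurableSpace X]
  [BorelSpace X] {H : Type*} [NormedAddCommGroup H] [InnerProductSpace ℝ H] [CompleteSpace H]
  {P₀ : Measure X} [IsProbabilityMeasure P₀] {ψ : X → H} {eig : ℕ → ℝ} {e : ℕ → Lp ℝ 2 P₀}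
  {c κ θ : ℝ}

/-- The second moment method for a finite family of combinations of eigenfunctions. -/
theorem one_le_typeI_add_typeII_alternatives (hψ : SteinAssumptions ψ P₀)
    (he : IsEigensystem (steinKernel ψ) P₀ eig e)
    (hM : MomentBound (steinKernel ψ) c κ P₀) {J : Type*} [Fintype J] [Nonempty J]
    (s : J → Finset ℕ) (a : J → ℕ → ℝ)
    (hb : ∀ j x, |∑ i ∈ s j, a j i * eigenfunction (steinKernel ψ) P₀ eig e i x| ≤ 1)
    {Δ : ℝ} (hΔ : ∀ j, Δ ≤ ∑ i ∈ s j, a j i ^ 2) {n : ℕ} {δ : ℝ} (hδ0 : 0 ≤ δ)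
    (hδ : (Fintype.card J : ℝ)⁻¹ ^ 2 *
      ∑ j, ∑ k, (1 + ∑ i ∈ s j ∩ s k, a j i * a k i) ^ n ≤ 1 + δ ^ 2)
    {φ : (Fin n → X) → ℝ≥0∞} (hφ : IsTest φ) :
    1 ≤ typeI P₀ φ + typeII (alternatives (steinKernel ψ) P₀ eig e (2 * c) κ θ Δ) φ +
      ENNReal.ofReal δ := by
  refine one_le_typeI_add_typeII_add P₀ (J := J)
    (u := fun j x => ∑ i ∈ s j, a j i * eigenfunction (steinKernel ψ) P₀ eig e i x)
    (fun j => Finset.measurable_fun_sum _ fun i _ =>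
      measurable_const.mul (continuous_eigenfunction hψ i).measurable) hb (fun j => ?_)
    (fun j => exists_mem_alternatives hψ he hM (s j) (a j) (hb j) (hΔ j)) hφ ?_
  · rw [integral_finsetSum _ fun i _ =>
      ((memLp_eigenfunction he i).integrable one_le_two).const_mul _]
    simp [integral_const_mul, integral_eigenfunction hψ]
  · simp only [integral_sum_mul_sum_eigenfunction he]
    exact (Real.sqrt_le_left hδ0).2 (by linarith)

/-- Bounded eigenfunctions: single eigenfunctions with a large random index cannot be detected. -/
theorem eventually_one_le_of_eigenfunctionsBounded (hψ : SteinAssumptions ψ P₀)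
    (he : IsEigensystem (steinKernel ψ) P₀ eig e) (hM : MomentBound (steinKernel ψ) c κ P₀)
    (hb : EigenfunctionsBounded (steinKernel ψ) P₀ eig e) {Δ : ℕ → ℝ} (hΔ : ∀ n, 0 < Δ n)
    (hlim : Tendsto Δ atTop (𝓝 0)) {δ : ℝ} (hδ : 0 < δ) :
    ∀ᶠ n in atTop, ∀ φ : (Fin n → X) → ℝ≥0∞, IsTest φ →
      1 ≤ typeI P₀ φ + typeII (alternatives (steinKernel ψ) P₀ eig e (2 * c) κ θ (Δ n)) φ +
        ENNReal.ofReal δ := by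
  obtain ⟨M, hb⟩ := hb
  have hlim' : Tendsto (fun n => √(Δ n) * M) atTop (𝓝 0) := by
    simpa using ((Real.continuous_sqrt.tendsto 0).comp hlim).mul_const M
  filter_upwards [hlim'.eventually_le_const one_pos] with n hn φ hφ
  -- `N` is chosen for this `n`, so large that the diagonal contribution `(1 + Δ n)ⁿ / N` is at most
  -- `δ²`.
  obtain ⟨N, hN⟩ := exists_nat_gt (max 1 ((1 + Δ n) ^ n / δ ^ 2))
  have hN1 : (1 : ℝ) < N := (le_max_left _ _).trans_lt hN
  have hN0 : (0 : ℝ) < N := by linarith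
  have hN2 : (1 + Δ n) ^ n ≤ N * δ ^ 2 := by
    have h1 := ((le_max_right _ _).trans_lt hN).le
    rwa [div_le_iff₀ (by positivity)] at h1
  have : NeZero N := ⟨by rintro rfl; simp at hN0⟩
  refine one_le_typeI_add_typeII_alternatives hψ he hM (J := Fin N) (fun j => {(j : ℕ)})
    (fun _ _ => √(Δ n)) (fun j x => ?_) (fun j => ?_) hδ.le ?_ hφ
  · rw [Finset.sum_singleton, abs_mul, abs_of_nonneg (Real.sqrt_nonneg _)]
    exact (mul_le_mul_of_nonneg_left (hb j x) (Real.sqrt_nonneg _)).trans hn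
  · simp [Real.sq_sqrt (hΔ n).le]
  · have hjk : ∀ j k : Fin N,
        (1 + ∑ _i ∈ ({(j : ℕ)} : Finset ℕ) ∩ {(k : ℕ)}, √(Δ n) * √(Δ n)) ^ n ≤
          1 + if j = k then (1 + Δ n) ^ n else 0 := by
      intro j k
      split_ifs with h
      · subst h
        simp [Real.mul_self_sqrt (hΔ n).le]
      · have : (j : ℕ) ≠ k := fun h' => h (Fin.ext h')
        rw [Finset.singleton_inter_of_notMem (by simpa using this)]
        simp
    calc _ ≤ (N : ℝ)⁻¹ ^ 2 * ∑ j : Fin N, ∑ k : Fin N,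
          (1 + if j = k then (1 + Δ n) ^ n else 0) := by
          rw [Fintype.card_fin]
          gcongr with j _ k _
          exact hjk j k
      _ = 1 + (1 + Δ n) ^ n / N := by
          simp only [Finset.sum_add_distrib, Finset.sum_const, Finset.card_univ, Fintype.card_fin,
            Finset.sum_ite_eq, Finset.mem_univ, if_true, nsmul_eq_mul]
          field_simp
      _ ≤ 1 + δ ^ 2 := by
          gcongr
          rwa [div_le_iff₀ hN0, mul_comm]

/-- Bounded rows: combinations of the first `B` eigenfunctions with random signs cannot be detected
if `(n Δ)² / B` is small. -/
theorem one_le_of_rowsBounded (hψ : SteinAssumptions ψ P₀)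
    (he : IsEigensystem (steinKernel ψ) P₀ eig e) (hm : MomentBound (steinKernel ψ) c κ P₀)
    {M : ℝ} (hM0 : 0 ≤ M)
    (hM : ∀ x, ∫⁻ y, ENNReal.ofReal (steinKernel ψ x y ^ 2) ∂P₀ ≤ ENNReal.ofReal M)
    {Δ : ℝ} (hΔ : 0 < Δ) {B : ℕ} (hB : 0 < B) (hBΔ : ∀ i < B, M * Δ ≤ eig i ^ 2) {n : ℕ} {δ : ℝ}
    (hδ0 : 0 ≤ δ) (hδ : Real.exp ((n * Δ) ^ 2 / B) ≤ 1 + δ ^ 2)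
    {φ : (Fin n → X) → ℝ≥0∞} (hφ : IsTest φ) :
    1 ≤ typeI P₀ φ + typeII (alternatives (steinKernel ψ) P₀ eig e (2 * c) κ θ Δ) φ +
      ENNReal.ofReal δ := by
  have hB0 : (0 : ℝ) < B := by exact_mod_cast hB
  -- The coefficient for which `B` squared coefficients sum to exactly `Δ`.
  set t : ℝ := √(Δ / B) with ht
  have ht2 : t ^ 2 = Δ / B := Real.sq_sqrt (by positivity)
  set a : (Fin B → Bool) → ℕ → ℝ := fun ε i => if h : i < B then t * boolSign (ε ⟨i, h⟩) else 0
    with ha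
  have ha2 : ∀ ε, ∀ i ∈ Finset.range B, a ε i ^ 2 = Δ / B := fun ε i hi => by
    simp only [ha]
    rw [dif_pos (Finset.mem_range.1 hi), mul_pow, boolSign_sq, ht2, mul_one]
  have hb : ∀ ε x, |∑ i ∈ Finset.range B, a ε i * eigenfunction (steinKernel ψ) P₀ eig e i x| ≤
      1 := by
    intro ε x
    refine (abs_sum_eigenfunction_le hψ he hM0 hM (Finset.range B) (a ε) x).trans ?_
    rw [Real.sqrt_le_one, Finset.mul_sum]
    calc ∑ i ∈ Finset.range B, M * (a ε i / eig i) ^ 2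
        ≤ ∑ i ∈ Finset.range B, (1 / B : ℝ) := by
          refine Finset.sum_le_sum fun i hi => ?_
          have h1 := hBΔ i (Finset.mem_range.1 hi)
          have h2 : 0 < eig i ^ 2 := pow_pos (he.pos i) 2
          rw [div_pow, ha2 ε i hi, div_div, ← mul_div_assoc, div_le_div_iff₀ (by positivity) hB0]
          nlinarith
      _ = 1 := by
          rw [Finset.sum_const, Finset.card_range, nsmul_eq_mul, mul_one_div_cancel hB0.ne']
  have hG : ∀ ε η, ∑ i ∈ Finset.range B ∩ Finset.range B, a ε i * a η i =
      ∑ i : Fin B, Δ / B * (boolSign (ε i) * boolSign (η i)) := by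
    intro ε η
    rw [Finset.inter_self, Finset.sum_range]
    refine Finset.sum_congr rfl fun i _ => ?_
    simp only [ha, i.2, dif_pos, Fin.eta]
    rw [← ht2]; ring
  -- Raising `1 + x ≤ exp x` to the power `n` needs a nonnegative base. The correlation is at least
  -- `-1`, being the integral of a product of functions bounded by `1`.
  have hG1 : ∀ ε η, 0 ≤ 1 + ∑ i ∈ Finset.range B ∩ Finset.range B, a ε i * a η i := by
    intro ε η
    rw [← integral_sum_mul_sum_eigenfunction he]
    have h1 := norm_integral_le_of_norm_le_const (μ := P₀) (C := 1)
      (f := fun x => (∑ i ∈ Finset.range B, a ε i * eigenfunction (steinKernel ψ) P₀ eig e i x) *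
        ∑ i ∈ Finset.range B, a η i * eigenfunction (steinKernel ψ) P₀ eig e i x)
      (ae_of_all _ fun x => by
        rw [Real.norm_eq_abs, abs_mul]
        exact mul_le_one₀ (hb ε x) (abs_nonneg _) (hb η x))
    rw [probReal_univ, mul_one, Real.norm_eq_abs] at h1
    linarith [(abs_le.1 h1).1]
  refine one_le_typeI_add_typeII_alternatives hψ he hm (fun _ => Finset.range B) a hb
    (fun ε => ?_) hδ0 ?_ hφ
  · rw [Finset.sum_congr rfl (ha2 ε), Finset.sum_const, Finset.card_range, nsmul_eq_mul,
      mul_div_cancel₀ _ hB0.ne']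
  · refine le_trans ?_ ((signs_exp_moment_le B (n * (Δ / B))).trans (le_trans ?_ hδ))
    · gcongr with ε _ η _
      calc _ ≤ Real.exp (∑ i ∈ Finset.range B ∩ Finset.range B, a ε i * a η i) ^ n := by
            refine pow_le_pow_left₀ (hG1 ε η) ?_ n
            rw [add_comm]; exact Real.add_one_le_exp _
        _ = _ := by
            rw [← Real.exp_nat_mul, hG, Finset.mul_sum]
            simp only [mul_assoc]
    · refine Real.exp_le_exp.2 ?_
      rw [div_eq_mul_inv ((n * Δ) ^ 2), div_eq_mul_inv Δ]
      have : (B : ℝ) * ((n * (Δ * (B : ℝ)⁻¹)) ^ 2 / 2) = ((n * Δ) ^ 2 * (B : ℝ)⁻¹) / 2 := by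
        field_simp
      rw [this]
      exact half_le_self (by positivity)

theorem eventually_one_le_of_rowsBounded (hψ : SteinAssumptions ψ P₀)
    (he : IsEigensystem (steinKernel ψ) P₀ eig e) (hm : MomentBound (steinKernel ψ) c κ P₀)
    {M : ℝ} (hM0 : 0 ≤ M)
    (hM : ∀ x, ∫⁻ y, ENNReal.ofReal (steinKernel ψ x y ^ 2) ∂P₀ ≤ ENNReal.ofReal M)
    {Δ : ℕ → ℝ} (hΔ : ∀ n, 0 < Δ n) {B : ℕ → ℕ}
    (hB : ∀ᶠ n in atTop, 0 < B n ∧ ∀ i < B n, M * Δ n ≤ eig i ^ 2)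
    (hlim : Tendsto (fun n => (n * Δ n) ^ 2 / B n) atTop (𝓝 0)) {δ : ℝ} (hδ : 0 < δ) :
    ∀ᶠ n in atTop, ∀ φ : (Fin n → X) → ℝ≥0∞, IsTest φ →
      1 ≤ typeI P₀ φ + typeII (alternatives (steinKernel ψ) P₀ eig e (2 * c) κ θ (Δ n)) φ +
        ENNReal.ofReal δ := by
  have h1 : Tendsto (fun n => Real.exp ((n * Δ n) ^ 2 / B n)) atTop (𝓝 1) := by
    simpa [Function.comp_def] using (Real.continuous_exp.tendsto 0).comp hlim
  have h2 : (1 : ℝ) < 1 + δ ^ 2 := by have := pow_pos hδ 2; linarith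
  filter_upwards [hB, h1.eventually_le_const h2] with n hn hn' φ hφ
  exact one_le_of_rowsBounded hψ he hm hM0 hM (hΔ n) hn.1 hn.2 hδ.le hn' hφ

end LowerBounds

/-! ### Choice of the dimension `B` from the eigenvalue decay -/

section Rates

theorem floor_pos_and_le_two_mul_floor {y : ℝ} (hy : 1 ≤ y) : 0 < ⌊y⌋₊ ∧ y ≤ 2 * ⌊y⌋₊ := by
  have h1 : 0 < ⌊y⌋₊ := Nat.floor_pos.2 hy
  have h2 : (1 : ℝ) ≤ ⌊y⌋₊ := by exact_mod_cast h1
  exact ⟨h1, by linarith [Nat.lt_floor_add_one y]⟩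

/-- The number of eigenfunctions to combine under polynomial decay. -/
theorem exists_dimension_of_polynomial_decay {eig Δ : ℕ → ℝ} {β M c₁ : ℝ} (hβ : 0 < β)
    (hc : 0 < c₁) (hM : 0 < M) (heig : ∀ i : ℕ, c₁ * ((i : ℝ) + 1) ^ (-β) ≤ eig i)
    (hΔ : ∀ n, 0 < Δ n)
    (hlim : Tendsto (fun n : ℕ => (n : ℝ) ^ (4 * β / (4 * β + 1)) * Δ n) atTop (𝓝 0))
    (hlim0 : Tendsto Δ atTop (𝓝 0)) :
    ∃ B : ℕ → ℕ, (∀ᶠ n in atTop, 0 < B n ∧ ∀ i < B n, M * Δ n ≤ eig i ^ 2) ∧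
      Tendsto (fun n => (n * Δ n) ^ 2 / B n) atTop (𝓝 0) := by
  set D : ℝ := M / c₁ ^ 2 with hD
  have hD0 : 0 < D := by positivity
  -- `y` solves `(c₁ y^(-β))² = M Δ`. Since indices start at `0` and `eig i` decays like `(i +
  -- 1)^(-β)`, every `i < ⌊y⌋` satisfies the constraint.
  set y : ℕ → ℝ := fun n => (D * Δ n) ^ (-(1 / (2 * β))) with hy
  have hDΔ : ∀ n, 0 < D * Δ n := fun n => mul_pos hD0 (hΔ n)
  have hy0 : ∀ n, 0 < y n := fun n => Real.rpow_pos_of_pos (hDΔ n) _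
  have hev : ∀ᶠ n in atTop, 1 ≤ y n := by
    have h1 : Tendsto (fun n => D * Δ n) atTop (𝓝 0) := by simpa using hlim0.const_mul D
    filter_upwards [h1.eventually_le_const one_pos] with n hn
    exact Real.one_le_rpow_of_pos_of_le_one_of_nonpos (hDΔ n) hn
      (neg_nonpos.2 (by positivity))
  refine ⟨fun n => ⌊y n⌋₊, ?_, ?_⟩
  · filter_upwards [hev] with n hn
    refine ⟨(floor_pos_and_le_two_mul_floor hn).1, fun i hi => ?_⟩
    have h1 : (i : ℝ) + 1 ≤ y n := by
      have : ((i + 1 : ℕ) : ℝ) ≤ ⌊y n⌋₊ := by exact_mod_cast hi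
      push_cast at this
      exact this.trans (Nat.floor_le (hy0 n).le)
    have h2 : y n ^ (-β) ≤ ((i : ℝ) + 1) ^ (-β) :=
      Real.rpow_le_rpow_of_nonpos (by positivity) h1 (by linarith)
    have h3 : (y n ^ (-β)) ^ 2 = D * Δ n := by
      rw [← Real.rpow_natCast, ← Real.rpow_mul (hy0 n).le, hy, ← Real.rpow_mul (hDΔ n).le]
      have : -(1 / (2 * β)) * (-β * ((2 : ℕ) : ℝ)) = 1 := by push_cast; field_simp
      rw [this, Real.rpow_one]
    calc M * Δ n = (c₁ * y n ^ (-β)) ^ 2 := by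
          rw [mul_pow, h3, hD]; field_simp
      _ ≤ eig i ^ 2 := by
          have h4 : 0 ≤ c₁ * y n ^ (-β) := mul_nonneg hc.le (Real.rpow_nonneg (hy0 n).le _)
          exact pow_le_pow_left₀ h4 ((mul_le_mul_of_nonneg_left h2 hc.le).trans (heig i)) 2
  · have hq : 0 < (4 * β + 1) / (2 * β) := by positivity
    -- `n² Δ² / y` equals `D^(1/(2β)) n² Δ^(2 + 1/(2β))`, and this is a power of `n^(4β/(4β+1)) Δ`
    -- up to the constant; the factor `2` pays for the floor.
    have hbig : Tendsto (fun n : ℕ => 2 * D ^ (1 / (2 * β)) *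
        ((n : ℝ) ^ (4 * β / (4 * β + 1)) * Δ n) ^ ((4 * β + 1) / (2 * β))) atTop (𝓝 0) := by
      have h1 := hlim.rpow_const (p := (4 * β + 1) / (2 * β)) (Or.inr hq.le)
      rw [Real.zero_rpow hq.ne'] at h1
      simpa using h1.const_mul (2 * D ^ (1 / (2 * β)))
    refine squeeze_zero' (Eventually.of_forall fun n => by positivity) ?_ hbig
    filter_upwards [hev] with n hn
    obtain ⟨h1, h2⟩ := floor_pos_and_le_two_mul_floor hn
    have h1' : (0 : ℝ) < ⌊y n⌋₊ := by exact_mod_cast h1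
    calc (n * Δ n) ^ 2 / ⌊y n⌋₊ ≤ 2 * ((n * Δ n) ^ 2 / y n) := by
          rw [div_le_iff₀ h1', mul_comm 2, mul_assoc, div_mul_eq_mul_div, le_div_iff₀ (hy0 n)]
          exact mul_le_mul_of_nonneg_left h2 (sq_nonneg _)
      _ = _ := by
          have hn0 : (0 : ℝ) ≤ n := n.cast_nonneg
          simp only [hy]
          rw [Real.rpow_neg (hDΔ n).le, div_inv_eq_mul, Real.mul_rpow hD0.le (hΔ n).le,
            Real.mul_rpow (Real.rpow_nonneg hn0 _) (hΔ n).le, ← Real.rpow_mul hn0]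
          have e1 : 4 * β / (4 * β + 1) * ((4 * β + 1) / (2 * β)) = (2 : ℕ) := by
            push_cast; field_simp; norm_num
          have e2 : (4 * β + 1) / (2 * β) = (2 : ℕ) + 1 / (2 * β) := by
            push_cast; field_simp; ring
          rw [e1, Real.rpow_natCast, e2, Real.rpow_add (hΔ n), Real.rpow_natCast]
          ring

/-- The number of eigenfunctions to combine under exponential decay. -/
theorem exists_dimension_of_exponential_decay {eig Δ : ℕ → ℝ} {τ M c₁ : ℝ} (hτ : 0 < τ)
    (hc : 0 < c₁) (heig : ∀ i : ℕ, c₁ * Real.exp (-τ * ((i : ℝ) + 1)) ≤ eig i)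
    (hΔ : ∀ n, 0 < Δ n)
    (hlim : Tendsto (fun n : ℕ => (n : ℝ) / √(Real.log n) * Δ n) atTop (𝓝 0)) :
    ∃ B : ℕ → ℕ, (∀ᶠ n in atTop, 0 < B n ∧ ∀ i < B n, M * Δ n ≤ eig i ^ 2) ∧
      Tendsto (fun n => (n * Δ n) ^ 2 / B n) atTop (𝓝 0) := by
  -- For `i < ⌊y⌋` this gives `λ_i² ≥ c₁² n^(-1/4)`, whereas eventually `Δ ≤ √(log n) / n ≤
  -- n^(-1/2)`. The spare factor `n^(1/4)` absorbs `M / c₁²`.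
  set y : ℕ → ℝ := fun n => Real.log n / (8 * τ) with hy
  have hlog : Tendsto (fun n : ℕ => Real.log n) atTop atTop :=
    Real.tendsto_log_atTop.comp tendsto_natCast_atTop_atTop
  have hev : ∀ᶠ n in atTop, 1 ≤ y n :=
    (hlog.atTop_div_const (by positivity)).eventually_ge_atTop 1
  have hexp : ∀ᶠ n : ℕ in atTop, M / c₁ ^ 2 ≤ Real.exp (Real.log n / 4) :=
    (Real.tendsto_exp_atTop.comp (hlog.atTop_div_const (by norm_num))).eventually_ge_atTop _
  refine ⟨fun n => ⌊y n⌋₊, ?_, ?_⟩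
  · filter_upwards [hev, hexp, hlim.eventually_le_const one_pos,
      hlog.eventually_gt_atTop 0, eventually_gt_atTop 0] with n hn hn1 hn2 hL hn0
    refine ⟨(floor_pos_and_le_two_mul_floor hn).1, fun i hi => ?_⟩
    have hn0' : (0 : ℝ) < n := by exact_mod_cast hn0
    set L := Real.log n with hLdef
    have h1 : (i : ℝ) + 1 ≤ y n := by
      have : ((i + 1 : ℕ) : ℝ) ≤ ⌊y n⌋₊ := by exact_mod_cast hi
      push_cast at this
      exact this.trans (Nat.floor_le (by linarith))
    have h2 : Real.exp (-(L / 8)) ≤ Real.exp (-τ * ((i : ℝ) + 1)) := by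
      refine Real.exp_le_exp.2 ?_
      have h3 : τ * ((i : ℝ) + 1) ≤ τ * (L / (8 * τ)) := mul_le_mul_of_nonneg_left h1 hτ.le
      have h4 : τ * (L / (8 * τ)) = L / 8 := by field_simp
      linarith
    have hΔle : Δ n ≤ Real.exp (-(L / 2)) := by
      have h3 : √L ≤ Real.exp (L / 2) := by
        refine Real.sqrt_le_iff.2 ⟨(Real.exp_pos _).le, ?_⟩
        rw [← Real.exp_nat_mul]
        have : ((2 : ℕ) : ℝ) * (L / 2) = L := by push_cast; ring
        rw [this]
        linarith [Real.add_one_le_exp L]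
      have h4 : n * Δ n ≤ √L := by
        rwa [div_mul_eq_mul_div, div_le_one (Real.sqrt_pos.2 hL)] at hn2
      have h5 : (n : ℝ) = Real.exp (L / 2) * Real.exp (L / 2) := by
        rw [← Real.exp_add, add_halves, hLdef, Real.exp_log hn0']
      have h6 := h4.trans h3
      rw [h5, mul_assoc] at h6
      have h7 : Real.exp (L / 2) * Δ n ≤ 1 :=
        le_of_mul_le_mul_left (by rwa [mul_one]) (Real.exp_pos (L / 2))
      rw [Real.exp_neg, ← one_div, le_div_iff₀ (Real.exp_pos _), mul_comm]
      exact h7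
    rw [div_le_iff₀ (by positivity)] at hn1
    calc M * Δ n ≤ (Real.exp (L / 4) * c₁ ^ 2) * Real.exp (-(L / 2)) := by
          exact mul_le_mul hn1 hΔle (hΔ n).le (by positivity)
      _ = (c₁ * Real.exp (-(L / 8))) ^ 2 := by
          have : Real.exp (-(L / 8)) ^ 2 = Real.exp (L / 4) * Real.exp (-(L / 2)) := by
            rw [← Real.exp_nat_mul, ← Real.exp_add]; congr 1; push_cast; ring
          rw [mul_pow, this]; ring
      _ ≤ eig i ^ 2 := by
          exact pow_le_pow_left₀ (by positivity)
            ((mul_le_mul_of_nonneg_left h2 hc.le).trans (heig i)) 2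
  · have hbig : Tendsto (fun n : ℕ => 16 * τ * ((n : ℝ) / √(Real.log n) * Δ n) ^ 2)
        atTop (𝓝 0) := by
      simpa using (hlim.pow 2).const_mul (16 * τ)
    refine squeeze_zero' (Eventually.of_forall fun n => by positivity) ?_ hbig
    filter_upwards [hev, hlog.eventually_gt_atTop 0] with n hn hL
    obtain ⟨h1, h2⟩ := floor_pos_and_le_two_mul_floor hn
    have h1' : (0 : ℝ) < ⌊y n⌋₊ := by exact_mod_cast h1
    have h3 : Real.log n ≤ 16 * τ * ⌊y n⌋₊ := by
      have h4 : Real.log n = 8 * τ * y n := by simp only [hy]; field_simp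
      rw [h4]; nlinarith
    rw [mul_pow, mul_pow (_ / _), div_pow, Real.sq_sqrt hL.le, div_le_iff₀ h1']
    have h5 : 16 * τ * ((n : ℝ) ^ 2 / Real.log n * Δ n ^ 2) * ⌊y n⌋₊ =
        (n : ℝ) ^ 2 * Δ n ^ 2 * (16 * τ * ⌊y n⌋₊) / Real.log n := by ring
    rw [h5, le_div_iff₀ hL]
    exact mul_le_mul_of_nonneg_left h3 (by positivity)

theorem tendsto_zero_of_le_mul {Δ f : ℕ → ℝ} (hΔ : ∀ n, 0 < Δ n) (hf : ∀ᶠ n in atTop, 1 ≤ f n)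
    (h : Tendsto (fun n => f n * Δ n) atTop (𝓝 0)) : Tendsto Δ atTop (𝓝 0) := by
  refine squeeze_zero' (Eventually.of_forall fun n => (hΔ n).le) ?_ h
  filter_upwards [hf] with n hn
  exact le_mul_of_one_le_left (hΔ n).le hn

end Rates

end SteinTest

end

/-! ### The theorem -/

theorem theorem3p3 {X : Type*} [TopologicalSpace X] [SecondCountableTopology X]
    [MeasurableSpace X] [BorelSpace X]
    {H : Type*} [NormedAddCommGroup H] [InnerProductSpace ℝ H] [CompleteSpace H]
    (P₀ : Measure X) [IsProbabilityMeasure P₀]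
    (ψ : X → H) (hψ : SteinTest.SteinAssumptions ψ P₀)
    (eig : ℕ → ℝ) (e : ℕ → Lp ℝ 2 P₀)
    (he : SteinTest.IsEigensystem (SteinTest.steinKernel ψ) P₀ eig e) :
    -- bounded eigenfunctions: the moment condition holds for some constants
    (SteinTest.EigenfunctionsBounded (SteinTest.steinKernel ψ) P₀ eig e →
      ∃ c κ : ℝ, 0 < c ∧ 0 < κ ∧ SteinTest.MomentBound (SteinTest.steinKernel ψ) c κ P₀) ∧
    -- the lower bounds, for any constants of the moment condition
    ∀ c κ : ℝ, 0 < c → 0 < κ → SteinTest.MomentBound (SteinTest.steinKernel ψ) c κ P₀ →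
      ∀ α : ℝ, 0 < α → α < 1 → ∀ Δ : ℕ → ℝ, (∀ n, 0 < Δ n) →
        -- polynomial decay
        (∀ β θ : ℝ, 1 < β →
          SteinTest.Comparable eig (fun i => ((i : ℝ) + 1) ^ (-β)) →
          Tendsto (fun n : ℕ => (n : ℝ) ^ (4 * θ * β / (4 * θ * β + 1)) * Δ n) atTop (𝓝 0) →
          ((1 ≤ θ ∧ SteinTest.RowsBounded (SteinTest.steinKernel ψ) P₀) ∨
            (1 / (4 * β) ≤ θ ∧
              SteinTest.EigenfunctionsBounded (SteinTest.steinKernel ψ) P₀ eig e)) →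
          SteinTest.NoConsistentTest P₀
            (fun n => SteinTest.alternatives (SteinTest.steinKernel ψ) P₀ eig e (2 * c) κ θ (Δ n))
            α) ∧
        -- exponential decay
        (∀ τ θ : ℝ, 0 < τ → 0 < θ →
          SteinTest.Comparable eig (fun i => Real.exp (-τ * ((i : ℝ) + 1))) →
          Tendsto (fun n : ℕ => (n : ℝ) / Real.sqrt (Real.log n) * Δ n) atTop (𝓝 0) →
          (SteinTest.RowsBounded (SteinTest.steinKernel ψ) P₀ ∨
            SteinTest.EigenfunctionsBounded (SteinTest.steinKernel ψ) P₀ eig e) →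
          SteinTest.NoConsistentTest P₀
            (fun n => SteinTest.alternatives (SteinTest.steinKernel ψ) P₀ eig e (2 * c) κ θ (Δ n))
            α) := by
  refine ⟨SteinTest.exists_momentBound_of_eigenfunctionsBounded hψ he, ?_⟩
  intro c κ _ _ hm α hα0 hα1 Δ hΔ
  have hrows : SteinTest.RowsBounded (SteinTest.steinKernel ψ) P₀ → ∃ M : ℝ, 0 < M ∧
      ∀ x, ∫⁻ y, ENNReal.ofReal (SteinTest.steinKernel ψ x y ^ 2) ∂P₀ ≤ ENNReal.ofReal M := by
    rintro ⟨M, hM⟩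
    exact ⟨max M 1, lt_max_of_lt_right one_pos, fun x =>
      (hM x).trans (ENNReal.ofReal_le_ofReal (le_max_left _ _))⟩
  constructor
  · rintro β θ hβ ⟨c₁, _, hc₁, _, hcomp⟩ hlim hcase
    have hpow : ∀ {p q : ℝ}, p ≤ q → ∀ᶠ n : ℕ in atTop, (n : ℝ) ^ p ≤ (n : ℝ) ^ q := fun hpq => by
      filter_upwards [eventually_ge_atTop 1] with n hn
      exact Real.rpow_le_rpow_of_exponent_le (by exact_mod_cast hn) hpq
    have hθ : 0 < θ := by
      rcases hcase with h | h
      · linarith [h.1]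
      · have : 0 < 1 / (4 * β) := by positivity
        linarith [h.1]
    have hlim0 : Tendsto Δ atTop (𝓝 0) := by
      refine SteinTest.tendsto_zero_of_le_mul hΔ ?_ hlim
      filter_upwards [hpow (p := 0) (q := 4 * θ * β / (4 * θ * β + 1)) (by positivity)] with n hn
      simpa using hn
    refine SteinTest.noConsistentTest_of_forall_le hα0 hα1 fun δ hδ => ?_
    rcases hcase with ⟨hθ1, hr⟩ | ⟨-, hb⟩
    · obtain ⟨M, hM0, hM⟩ := hrows hr
      have hlim1 : Tendsto (fun n : ℕ => (n : ℝ) ^ (4 * β / (4 * β + 1)) * Δ n) atTop (𝓝 0) := by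
        refine squeeze_zero' (Eventually.of_forall fun n =>
          mul_nonneg (Real.rpow_nonneg n.cast_nonneg _) (hΔ n).le) ?_ hlim
        -- The rate exponent increases with `θ`, so for `θ ≥ 1` the assumption implies the one for
        -- `θ = 1`, which is what the sign family needs.
        have hpq : 4 * β / (4 * β + 1) ≤ 4 * θ * β / (4 * θ * β + 1) := by
          rw [div_le_div_iff₀ (by positivity) (by positivity)]
          nlinarith
        filter_upwards [hpow hpq] with n hn
        exact mul_le_mul_of_nonneg_right hn (hΔ n).le
      obtain ⟨B, hB, hBlim⟩ := SteinTest.exists_dimension_of_polynomial_decay (by linarith) hc₁ hM0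
        (fun i => (hcomp i).1) hΔ hlim1 hlim0
      exact SteinTest.eventually_one_le_of_rowsBounded hψ he hm hM0.le hM hΔ hB hBlim hδ
    · exact SteinTest.eventually_one_le_of_eigenfunctionsBounded hψ he hm hb hΔ hlim0 hδ
  · rintro τ θ hτ - ⟨c₁, _, hc₁, _, hcomp⟩ hlim hcase
    refine SteinTest.noConsistentTest_of_forall_le hα0 hα1 fun δ hδ => ?_
    rcases hcase with hr | hb
    · obtain ⟨M, hM0, hM⟩ := hrows hr
      obtain ⟨B, hB, hBlim⟩ := SteinTest.exists_dimension_of_exponential_decay (M := M) hτ hc₁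
        (fun i => (hcomp i).1) hΔ hlim
      exact SteinTest.eventually_one_le_of_rowsBounded hψ he hm hM0.le hM hΔ hB hBlim hδ
    · have hlim0 : Tendsto Δ atTop (𝓝 0) := by
        refine SteinTest.tendsto_zero_of_le_mul hΔ ?_ hlim
        filter_upwards [eventually_ge_atTop 2] with n hn
        have h2 : (2 : ℝ) ≤ n := by exact_mod_cast hn
        rw [one_le_div (Real.sqrt_pos.2 (Real.log_pos (by linarith)))]
        refine Real.sqrt_le_iff.2 ⟨by linarith, ?_⟩
        nlinarith [Real.log_le_sub_one_of_pos (by linarith : (0 : ℝ) < n)]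
      exact SteinTest.eventually_one_le_of_eigenfunctionsBounded hψ he hm hb hΔ hlim0 hδ
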